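/- Let $r,q,\beta,i,\tau_1,\tau_2\in\mathbb R$, $\sigma>0$, $T>0$, $\tau_3>0$, $L\ge 0$, $K\ge 0$. Write $$N(x)=\frac1{\sqrt{2\pi}}\int_{-\infty}^{x}e^{-t^2/2}\,dt,\qquad N_2(a_1,a_2;\rho)=\frac{1}{2\pi\sqrt{1-\rho^2}}\int_{-\infty}^{a_1}\!\int_{-\infty}^{a_2}e^{-\frac{y_1^2-2\rho y_1y_2+y_2^2}{2(1-\rho^2)}}\,dy_2\,dy_1\quad(|\rho|<1),$$ $$\delta(x,\theta_1,\theta_2,\theta_3)=\frac{\ln x+\left(r-q-\frac{\sigma^2}{2}\right)\theta_1+\sigma^2\theta_2}{\sigma\sqrt{\theta_3}}\quad(\theta_3>0),$$ where the arguments of $N$ and $N_2$ may be $\pm\infty$ and $\ln(x/0)=+\infty$ for $x>0$. For $f:(0,\infty)\to\mathbb R$ consider the Black–Scholes terminal value problem $$\frac{\partial V}{\partial t}+\frac12\sigma^2X^2\frac{\partial^2V}{\partial X^2}+(r-q)X\frac{\partial V}{\partial X}-rV=0\quad(0<t<T,\ X>0),\qquad V(X,T)=f(X)\quad(X>0).$$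 A solution means a function $V$ on $(0,\infty)\times(0,T)$ that is continuous together with $V_t,V_X,V_{XX}$, satisfies the equation, satisfies $V(X',t)\to f(X)$ as $(X',t)\to(X,T)$, $t<T$, at every point $X>0$ of continuity of $f$, and obeys a bound $|V(X,t)|\le A\,e^{B(\ln X)^2}$ on $(0,\infty)\times(0,T)$ for some constants $A,B$. For the payoff $$f(X)=X^\beta\,N\!\left[\delta\!\left(X^i/L,\tau_1,\tau_2,\tau_3\right)\right]\cdot 1\{X>K\}$$ the problem has exactly one solution, namely, with $\tau=T-t$, $$V(X,t)=X^\beta e^{\mu(\beta)\tau}N_2(a_1,a_2;\rho),$$ where $$\mu(\beta)=-r+\beta\left[r-q-\frac{\sigma^2}{2}(1-\beta)\right],\qquad \rho=i\sqrt{\frac{\tau}{\tau_3+i^2\tau}},$$ $$a_1=\delta\!\left(X^i/L,\ \tau_1+i\tau,\ \tau_2+i\beta\tau,\ \tau_3+i^2\tau\right),\qquad a_2=\delta\!\left(X/K,\ \tau,\ \beta\tau,\ \tau\right).$$ Likewise, for the payoff with $1\{X<K\}$ in place of $1\{X>K\}$ the problem has exactly one solution, namely $V(X,t)=X^\beta e^{\mu(\beta)\tau}N_2(a_1,-a_2;-\rho)$.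 -/

import Mathlib

open Filter Topology MeasureTheory Set
open scoped ENNReal

noncomputable section

namespace BlackScholes

/-- The standard normal distribution function, `N(x) = (2π)^{-1/2} ∫_{-∞}^x e^{-t²/2} dt`,
for `x ∈ [-∞, +∞]`. -/
def N (x : EReal) : ℝ :=
  (√(2 * Real.pi))⁻¹ * ∫ t in {t : ℝ | (t : EReal) ≤ x}, Real.exp (-t ^ 2 / 2)

/-- The bivariate normal distribution function with correlation `ρ`, `|ρ| < 1`,
for `a₁, a₂ ∈ [-∞, +∞]`. -/
def N₂ (a₁ a₂ : EReal) (ρ : ℝ) : ℝ :=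
  (2 * Real.pi * √(1 - ρ ^ 2))⁻¹ *
    ∫ y₁ in {y : ℝ | (y : EReal) ≤ a₁}, ∫ y₂ in {y : ℝ | (y : EReal) ≤ a₂},
      Real.exp (-(y₁ ^ 2 - 2 * ρ * y₁ * y₂ + y₂ ^ 2) / (2 * (1 - ρ ^ 2)))

/-- `δ(x, τ₁, τ₂, τ₃) = [ln x + (r - q - σ²/2) τ₁ + σ² τ₂] / (σ √τ₃)`. The argument `x` ranges over
`[0, +∞]` and `ln (+∞) = +∞`, so that `x = X / K` with `X > 0` makes sense for `K = 0` as well. -/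
def delta (r q σ : ℝ) (x : ℝ≥0∞) (τ₁ τ₂ τ₃ : ℝ) : EReal :=
  (ENNReal.log x + (((r - q - σ ^ 2 / 2) * τ₁ + σ ^ 2 * τ₂ : ℝ) : EReal)) /
    ((σ * √τ₃ : ℝ) : EReal)

/-- `μ(β) = -r + β [r - q - (σ²/2)(1 - β)]`. -/
def mu (r q σ β : ℝ) : ℝ :=
  -r + β * (r - q - σ ^ 2 / 2 * (1 - β))

/-- `ρ = i √(τ / (τ₃ + i² τ))`. -/
def rho (i τ₃ τ : ℝ) : ℝ :=
  i * √(τ / (τ₃ + i ^ 2 * τ))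

/-- `a₁ = δ(X^i / L, τ₁ + iτ, τ₂ + iβτ, τ₃ + i²τ)`. -/
def a₁ (r q σ β i L τ₁ τ₂ τ₃ X τ : ℝ) : EReal :=
  delta r q σ (ENNReal.ofReal (X ^ i) / ENNReal.ofReal L)
    (τ₁ + i * τ) (τ₂ + i * β * τ) (τ₃ + i ^ 2 * τ)

/-- `a₂ = δ(X / K, τ, βτ, τ)`. -/
def a₂ (r q σ β K X τ : ℝ) : EReal :=
  delta r q σ (ENNReal.ofReal X / ENNReal.ofReal K) τ (β * τ) τ

/-- The payoff `X^β N[δ(X^i / L, τ₁, τ₂, τ₃)] · 1{X ∈ A}`. -/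
def payoff (r q σ β i L τ₁ τ₂ τ₃ : ℝ) (A : Set ℝ) (X : ℝ) : ℝ :=
  A.indicator
    (fun x => x ^ β * N (delta r q σ (ENNReal.ofReal (x ^ i) / ENNReal.ofReal L) τ₁ τ₂ τ₃)) X

/-- `V(X, t)` is a classical solution, for `X > 0` and `0 < t < T`, of the Black–Scholes terminal
value problem with terminal payoff `f`: it is of class `C^{2,1}` and solves the equation, it
converges to `f` as `t ↑ T` at every point of continuity of `f`, and it lies in the Tychonoff growth
class `|V(X, t)| ≤ A exp(B (ln X)²)` (for some `A`, `B`, uniformly in `t`). -/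
structure IsSolution (r q σ T : ℝ) (f : ℝ → ℝ) (V : ℝ → ℝ → ℝ) : Prop where
  continuousOn : ContinuousOn (fun p : ℝ × ℝ => V p.1 p.2) (Ioi 0 ×ˢ Ioo 0 T)
  equation : ∃ Vt VX VXX : ℝ → ℝ → ℝ,
    ContinuousOn (fun p : ℝ × ℝ => Vt p.1 p.2) (Ioi 0 ×ˢ Ioo 0 T) ∧
    ContinuousOn (fun p : ℝ × ℝ => VX p.1 p.2) (Ioi 0 ×ˢ Ioo 0 T) ∧
    ContinuousOn (fun p : ℝ × ℝ => VXX p.1 p.2) (Ioi 0 ×ˢ Ioo 0 T) ∧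
    ∀ X ∈ Ioi (0 : ℝ), ∀ t ∈ Ioo 0 T,
      HasDerivAt (fun s => V X s) (Vt X t) t ∧
      HasDerivAt (fun x => V x t) (VX X t) X ∧
      HasDerivAt (fun x => VX x t) (VXX X t) X ∧
      Vt X t + 1 / 2 * σ ^ 2 * X ^ 2 * VXX X t + (r - q) * X * VX X t - r * V X t = 0
  terminal : ∀ X ∈ Ioi (0 : ℝ), ContinuousAt f X →
    Tendsto (fun p : ℝ × ℝ => V p.1 p.2) (𝓝 X ×ˢ 𝓝[<] T) (𝓝 (f X))
  growth : ∃ A B : ℝ, ∀ X ∈ Ioi (0 : ℝ), ∀ t ∈ Ioo 0 T,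
    |V X t| ≤ A * Real.exp (B * Real.log X ^ 2)

/-- `V` is the solution of the terminal value problem: it is a solution, and every solution agrees
with it for `X > 0` and `0 < t < T`. -/
def IsTheSolution (r q σ T : ℝ) (f : ℝ → ℝ) (V : ℝ → ℝ → ℝ) : Prop :=
  IsSolution r q σ T f V ∧
    ∀ W : ℝ → ℝ → ℝ, IsSolution r q σ T f W →
      ∀ X ∈ Ioi (0 : ℝ), ∀ t ∈ Ioo 0 T, W X t = V X t

end BlackScholes

end

open BlackScholes

/-! Existence. With `x = ln X` and `s = T - t`, factoring `X^β e^{μ(β)s}` out of the solution leaves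
the heat equation with drift `d = r - q - σ²/2 + σ²β` and initial value `F(x)`, the payoff divided
by `X^β`. Its solution is the Gaussian mean `E[F(x + ds + σ√s Z)]`, smooth for `s > 0` even though
`F` jumps (`exists_hasPartials_gaussianMean`, `isSolution_of_eq_gaussianMean`).

Closed form. The factor `N[δ]` in `F` is the probability that a second, independent standard normal
variable lies below `δ`. The mean is therefore the probability of two linear inequalities in two
independent normals. Normalising the first one gives variance `τ₃ + i²τ` and correlation `±ρ` with
the second, that is, `N₂` (`N₂_eq_integral`, `gaussianMean_logPayoff`).

Uniqueness. The terminal condition says nothing at the jump `X = K`, so Tychonoff's theorem is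
needed with one exceptional initial point (`HasPartials.eq_zero`). The comparison function has two
terms: a multiple `ε` of a barrier outgrowing `e^{Bx²}`, and a bounded heat kernel of width `ε`
centred at the exceptional point. The kernel dominates the solution near that point, and both terms
tend to zero at each fixed later time as `ε → 0`. -/

namespace BlackScholes

/-! ### Functions with the partial derivatives of a parabolic equation -/

/-- `us`, `ux`, `uxx` are the partial derivatives of the continuous function `u(x, s)`,
for `x` real and `s ∈ I`. -/
structure HasPartials (I : Set ℝ) (u us ux uxx : ℝ → ℝ → ℝ) : Prop where
  cont : ContinuousOn (fun p : ℝ × ℝ => u p.1 p.2) (univ ×ˢ I)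
  time : ∀ x, ∀ s ∈ I, HasDerivAt (fun s => u x s) (us x s) s
  space : ∀ x, ∀ s ∈ I, HasDerivAt (fun x => u x s) (ux x s) x
  space₂ : ∀ x, ∀ s ∈ I, HasDerivAt (fun x => ux x s) (uxx x s) x

namespace HasPartials

variable {I J : Set ℝ} {u us ux uxx v vs vx vxx : ℝ → ℝ → ℝ}

theorem add (hu : HasPartials I u us ux uxx) (hv : HasPartials I v vs vx vxx) :
    HasPartials I (fun x s => u x s + v x s) (fun x s => us x s + vs x s)
      (fun x s => ux x s + vx x s) (fun x s => uxx x s + vxx x s) where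
  cont := hu.cont.add hv.cont
  time x s hs := (hu.time x s hs).add (hv.time x s hs)
  space x s hs := (hu.space x s hs).add (hv.space x s hs)
  space₂ x s hs := (hu.space₂ x s hs).add (hv.space₂ x s hs)

theorem const_mul (c : ℝ) (hu : HasPartials I u us ux uxx) :
    HasPartials I (fun x s => c * u x s) (fun x s => c * us x s)
      (fun x s => c * ux x s) (fun x s => c * uxx x s) where
  cont := continuousOn_const.mul hu.cont
  time x s hs := (hu.time x s hs).const_mul c
  space x s hs := (hu.space x s hs).const_mul c
  space₂ x s hs := (hu.space₂ x s hs).const_mul c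

theorem mono (h : J ⊆ I) (hu : HasPartials I u us ux uxx) : HasPartials J u us ux uxx where
  cont := hu.cont.mono (prod_mono_right h)
  time x s hs := hu.time x s (h hs)
  space x s hs := hu.space x s (h hs)
  space₂ x s hs := hu.space₂ x s (h hs)

theorem shift (c : ℝ) (h : ∀ s ∈ J, c + s ∈ I) (hu : HasPartials I u us ux uxx) :
    HasPartials J (fun x s => u x (c + s)) (fun x s => us x (c + s))
      (fun x s => ux x (c + s)) (fun x s => uxx x (c + s)) where
  cont := hu.cont.comp (f := fun p : ℝ × ℝ => (p.1, c + p.2)) (by fun_prop)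
    (fun p hp => ⟨mem_univ _, h _ hp.2⟩)
  time x s hs := (hu.time x _ (h s hs)).comp_const_add c s
  space x s hs := hu.space x _ (h s hs)
  space₂ x s hs := hu.space₂ x _ (h s hs)

end HasPartials

/-! ### Maximum principle and barriers -/

/-- If `f'' < 0`, the second derivative test makes `x` a local maximum too, so `f` is constant near
`x` and `f'' = 0`. -/
theorem second_deriv_nonneg_of_isLocalMin {f f' : ℝ → ℝ} {x f'' : ℝ}
    (hf : ∀ y, HasDerivAt f (f' y) y) (hf' : HasDerivAt f' f'' x) (hmin : IsLocalMin f x) :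
    0 ≤ f'' := by
  by_contra! hneg
  have hd : deriv f = f' := funext fun y => (hf y).deriv
  have h0 : f' x = 0 := hmin.hasDerivAt_eq_zero (hf x)
  have hmax : IsLocalMax f x := by
    apply isLocalMax_of_deriv_deriv_neg
    · rw [hd, hf'.deriv]; exact hneg
    · rw [hd, h0]
    · exact (hf x).continuousAt
  have hconst : f =ᶠ[𝓝 x] fun _ => f x := by
    filter_upwards [hmin, hmax] with y h1 h2 using le_antisymm h2 h1
  have h1 : f' =ᶠ[𝓝 x] fun _ => 0 := by
    have := hconst.deriv
    rw [hd] at this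
    simpa using this
  have h2 : f'' = 0 := by
    rw [← hf'.deriv, h1.deriv_eq]; simp
  exact hneg.ne h2

/-- One-sided because the minimum over a space-time rectangle may lie on its final edge, where only
earlier times are available for comparison. -/
theorem deriv_nonpos_of_forall_left_ge {f : ℝ → ℝ} {s c f' : ℝ} (hc : c < s)
    (hf : HasDerivAt f f' s) (hmin : ∀ y ∈ Ioo c s, f s ≤ f y) : f' ≤ 0 := by
  have ht : Tendsto (slope f s) (𝓝[<] s) (𝓝 f') :=
    (hasDerivAt_iff_tendsto_slope.1 hf).mono_left
      (nhdsWithin_mono _ (fun y hy => ne_of_lt hy))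
  refine le_of_tendsto ht ?_
  filter_upwards [Ioo_mem_nhdsLT hc] with y hy
  rw [slope_def_field]
  exact div_nonpos_of_nonneg_of_nonpos (by linarith [hmin y hy]) (by linarith [hy.2])

/-- A strict supersolution of `u_s = a u_xx + b u_x` that is positive initially and for large `|x|`
is nonnegative. -/
theorem HasPartials.nonneg_of_strict_supersolution {a b S R : ℝ} {u us ux uxx : ℝ → ℝ → ℝ}
    (ha : 0 ≤ a) (hu : HasPartials (Ioo 0 S) u us ux uxx)
    (hsuper : ∀ x, ∀ s ∈ Ioo 0 S, a * uxx x s + b * ux x s < us x s)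
    (hinit : ∀ x, ∀ᶠ p : ℝ × ℝ in 𝓝 x ×ˢ 𝓝[>] 0, 0 < u p.1 p.2)
    (hout : ∀ x, R ≤ |x| → ∀ s ∈ Ioo 0 S, 0 < u x s) :
    ∀ x, ∀ s ∈ Ioo 0 S, 0 ≤ u x s := by
  intro x s hs
  by_contra! hneg
  have hxR : |x| < R := by
    by_contra! h
    exact absurd (hout x h s hs) hneg.not_gt
  have hR : 0 < R := (abs_nonneg x).trans_lt hxR
  -- Compactness of `[-R, R]` makes the pointwise initial positivity uniform. A negative minimum
  -- over `[-R, R] × [c, s]` then avoids the initial and lateral edges, so there `u_x = 0`, `u_xx ≥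
  -- 0` and `u_s ≤ 0`, against strictness.
  have hstart : ∀ᶠ c in 𝓝[>] (0 : ℝ), ∀ y ∈ Icc (-R) R, 0 < u y c := by
    have key : ∀ᶠ c in 𝓝 (0 : ℝ), ∀ y ∈ Icc (-R) R, 0 < c → 0 < u y c := by
      refine isCompact_Icc.eventually_forall_of_forall_eventually
        (P := fun c y => 0 < c → 0 < u y c) fun y _ => ?_
      obtain ⟨pa, hpa, pb, hpb, hab⟩ := eventually_prod_iff.1 (hinit y)
      exact ((eventually_nhdsWithin_iff.1 hpb).prod_nhds hpa).mono
        fun z hz hz0 => hab hz.2 (hz.1 hz0)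
    filter_upwards [key.filter_mono nhdsWithin_le_nhds, self_mem_nhdsWithin] with c h hc y hy
      using h y hy hc
  obtain ⟨c, hc, hc0, hcs⟩ : ∃ c, (∀ y ∈ Icc (-R) R, 0 < u y c) ∧ 0 < c ∧ c < s :=
    (hstart.and (Ioo_mem_nhdsGT hs.1)).exists
  have hsub : Icc (-R) R ×ˢ Icc c s ⊆ univ ×ˢ Ioo 0 S :=
    prod_mono (subset_univ _) fun y hy => ⟨hc0.trans_le hy.1, hy.2.trans_lt hs.2⟩
  obtain ⟨⟨y, t⟩, ⟨hy, ht⟩, hmin⟩ :=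
    (isCompact_Icc.prod isCompact_Icc).exists_isMinOn
      ⟨(x, s), ⟨abs_le.1 hxR.le, ⟨hcs.le, le_rfl⟩⟩⟩ (hu.cont.mono hsub)
  have hmin' : ∀ y' ∈ Icc (-R) R, ∀ t' ∈ Icc c s, u y t ≤ u y' t' :=
    fun y' hy' t' ht' => hmin (a := (y', t')) ⟨hy', ht'⟩
  have hyt : u y t < 0 := (hmin' x (abs_le.1 hxR.le) s ⟨hcs.le, le_rfl⟩).trans_lt hneg
  have htS : t ∈ Ioo 0 S := (hsub (show (y, t) ∈ _ from ⟨hy, ht⟩)).2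
  have hct : c < t := by
    refine lt_of_le_of_ne ht.1 ?_
    rintro rfl
    exact absurd (hc y hy) hyt.not_gt
  have hyR : |y| < R := by
    by_contra! h
    exact absurd (hout y h t htS) hyt.not_gt
  have hloc : IsLocalMin (fun y => u y t) y := by
    filter_upwards [Ioo_mem_nhds (abs_lt.1 hyR).1 (abs_lt.1 hyR).2] with y' hy'
    exact hmin' y' ⟨hy'.1.le, hy'.2.le⟩ t ht
  have h1 : ux y t = 0 := hloc.hasDerivAt_eq_zero (hu.space y t htS)
  have h2 : 0 ≤ uxx y t :=
    second_deriv_nonneg_of_isLocalMin (fun z => hu.space z t htS) (hu.space₂ y t htS) hloc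
  have h3 : us y t ≤ 0 := deriv_nonpos_of_forall_left_ge hct (hu.time y t htS)
    fun t' ht' => hmin' y hy t' ⟨ht'.1.le, ht'.2.le.trans ht.2⟩
  have h4 := hsuper y t htS
  rw [h1] at h4
  nlinarith [mul_nonneg ha h2]

/-- A backward heat kernel moving with the drift, with its factor `(2θ - s)^{-1/2}` replaced by
`e^{s/θ}`. The defect `u_s - a u_xx - b u_x` is then `u (1/θ - 1/(2(2θ - s)))`, positive for `0 < s
< θ`. -/
theorem hasPartials_growth_barrier {a b θ : ℝ} (ha : 0 < a) :
    HasPartials (Ioo 0 θ)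
      (fun x s => Real.exp (s / θ + (x + b * s) ^ 2 / (4 * a * (2 * θ - s))))
      (fun x s => Real.exp (s / θ + (x + b * s) ^ 2 / (4 * a * (2 * θ - s))) *
        (1 / θ + b * (x + b * s) / (2 * a * (2 * θ - s)) +
          (x + b * s) ^ 2 / (4 * a * (2 * θ - s) ^ 2)))
      (fun x s => Real.exp (s / θ + (x + b * s) ^ 2 / (4 * a * (2 * θ - s))) *
        ((x + b * s) / (2 * a * (2 * θ - s))))
      (fun x s => Real.exp (s / θ + (x + b * s) ^ 2 / (4 * a * (2 * θ - s))) *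
        (((x + b * s) / (2 * a * (2 * θ - s))) ^ 2 + 1 / (2 * a * (2 * θ - s)))) := by
  have hpos : ∀ s ∈ Ioo 0 θ, 0 < 2 * θ - s := fun s hs => by linarith [hs.1, hs.2]
  have hE : ∀ x, ∀ s ∈ Ioo 0 θ, HasDerivAt
      (fun x => Real.exp (s / θ + (x + b * s) ^ 2 / (4 * a * (2 * θ - s))))
      (Real.exp (s / θ + (x + b * s) ^ 2 / (4 * a * (2 * θ - s))) *
        ((x + b * s) / (2 * a * (2 * θ - s)))) x := by
    intro x s hs
    have := hpos s hs
    have h : HasDerivAt (fun x => s / θ + (x + b * s) ^ 2 / (4 * a * (2 * θ - s)))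
        ((x + b * s) / (2 * a * (2 * θ - s))) x :=
      (((((hasDerivAt_id' x).add_const (b * s)).fun_pow 2).div_const
        (4 * a * (2 * θ - s))).const_add (s / θ)).congr_deriv (by field_simp; norm_num; ring)
    exact h.exp
  refine ⟨?_, ?_, hE, ?_⟩
  · intro p hp
    have := hpos p.2 hp.2
    have : 4 * a * (2 * θ - p.2) ≠ 0 := by positivity
    refine ContinuousAt.continuousWithinAt ?_
    fun_prop (disch := assumption)
  · intro x s hs
    have := (hpos s hs).ne'
    have hθ : 0 < θ := hs.1.trans hs.2
    have h1 : HasDerivAt (fun s => (x + b * s) ^ 2) (2 * (x + b * s) * b) s :=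
      ((((hasDerivAt_id' s).const_mul b).const_add x).fun_pow 2).congr_deriv (by simp)
    have h2 : HasDerivAt (fun s => 4 * a * (2 * θ - s)) (4 * a * (-1)) s :=
      ((hasDerivAt_id s).const_sub (2 * θ)).const_mul _
    have h : HasDerivAt (fun s => s / θ + (x + b * s) ^ 2 / (4 * a * (2 * θ - s)))
        (1 / θ + b * (x + b * s) / (2 * a * (2 * θ - s)) +
          (x + b * s) ^ 2 / (4 * a * (2 * θ - s) ^ 2)) s :=
      (((hasDerivAt_id' s).div_const θ).fun_add (h1.fun_div h2 (by positivity))).congr_deriv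
        (by generalize 2 * θ - s = D at this; field_simp; ring)
    exact h.exp
  · intro x s hs
    exact ((hE x s hs).fun_mul (((hasDerivAt_id' x).add_const (b * s)).div_const
      (2 * a * (2 * θ - s)))).congr_deriv (by ring)

/-- An exact solution: the heat kernel started at time `-h²`, scaled to have height 1 at `(x₀, 0)`.
It stays above a constant independent of `h` at distance and time of order `h` and `h²`, and is at
most `h/√s` at time `s`. -/
theorem hasPartials_heat_kernel {a b h x₀ : ℝ} (ha : 0 < a) (hh : 0 < h) :
    HasPartials (Ioi 0)
      (fun x s => h / √(s + h ^ 2) * Real.exp (-(x - x₀ + b * s) ^ 2 / (4 * a * (s + h ^ 2))))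
      (fun x s => h / √(s + h ^ 2) * Real.exp (-(x - x₀ + b * s) ^ 2 / (4 * a * (s + h ^ 2))) *
        (-1 / (2 * (s + h ^ 2)) - b * (x - x₀ + b * s) / (2 * a * (s + h ^ 2)) +
          (x - x₀ + b * s) ^ 2 / (4 * a * (s + h ^ 2) ^ 2)))
      (fun x s => h / √(s + h ^ 2) * Real.exp (-(x - x₀ + b * s) ^ 2 / (4 * a * (s + h ^ 2))) *
        (-(x - x₀ + b * s) / (2 * a * (s + h ^ 2))))
      (fun x s => h / √(s + h ^ 2) * Real.exp (-(x - x₀ + b * s) ^ 2 / (4 * a * (s + h ^ 2))) *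
        (((x - x₀ + b * s) / (2 * a * (s + h ^ 2))) ^ 2 - 1 / (2 * a * (s + h ^ 2)))) := by
  have hpos : ∀ s ∈ Ioi (0 : ℝ), 0 < s + h ^ 2 := fun s hs => by
    have : (0 : ℝ) < s := hs
    positivity
  have hE : ∀ x, ∀ s ∈ Ioi (0 : ℝ), HasDerivAt
      (fun x => h / √(s + h ^ 2) * Real.exp (-(x - x₀ + b * s) ^ 2 / (4 * a * (s + h ^ 2))))
      (h / √(s + h ^ 2) * Real.exp (-(x - x₀ + b * s) ^ 2 / (4 * a * (s + h ^ 2))) *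
        (-(x - x₀ + b * s) / (2 * a * (s + h ^ 2)))) x := by
    intro x s hs
    have := hpos s hs
    have h : HasDerivAt (fun x => -(x - x₀ + b * s) ^ 2 / (4 * a * (s + h ^ 2)))
        (-(x - x₀ + b * s) / (2 * a * (s + h ^ 2))) x :=
      ((((((hasDerivAt_id' x).sub_const x₀).add_const (b * s)).fun_pow 2).fun_neg).div_const
        (4 * a * (s + h ^ 2))).congr_deriv (by field_simp; norm_num; ring)
    exact (h.exp.const_mul _).congr_deriv (by ring)
  refine ⟨?_, ?_, hE, ?_⟩
  · intro p hp
    have hp' := hpos p.2 hp.2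
    have h1 : 4 * a * (p.2 + h ^ 2) ≠ 0 := by positivity
    have h2 : √(p.2 + h ^ 2) ≠ 0 := by positivity
    refine ContinuousAt.continuousWithinAt ?_
    fun_prop (disch := assumption)
  · intro x s hs
    have hs' := hpos s hs
    have hq : √(s + h ^ 2) ^ 2 = s + h ^ 2 := Real.sq_sqrt hs'.le
    have hq0 : √(s + h ^ 2) ≠ 0 := by positivity
    have h1 : HasDerivAt (fun s => -(x - x₀ + b * s) ^ 2) (-(2 * (x - x₀ + b * s) * b)) s :=
      ((((hasDerivAt_id' s).const_mul b).const_add (x - x₀)).fun_pow 2).fun_neg.congr_deriv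
        (by simp)
    have h2 : HasDerivAt (fun s => 4 * a * (s + h ^ 2)) (4 * a * 1) s :=
      ((hasDerivAt_id' s).add_const (h ^ 2)).const_mul _
    have h3 : HasDerivAt (fun s => h / √(s + h ^ 2))
        (h / √(s + h ^ 2) * (-1 / (2 * (s + h ^ 2)))) s :=
      ((hasDerivAt_const s h).fun_div
        (((hasDerivAt_id' s).add_const (h ^ 2)).sqrt hs'.ne') hq0).congr_deriv
        (by rw [hq]; field_simp; simp)
    exact (h3.fun_mul (h1.fun_div h2 (by positivity)).exp).congr_deriv (by field_simp; ring)
  · intro x s hs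
    exact ((hE x s hs).fun_mul ((((hasDerivAt_id' x).sub_const x₀).add_const
      (b * s)).fun_neg.div_const (2 * a * (s + h ^ 2)))).congr_deriv (by ring)

/-- Combine `4a(2θ - s) ≤ 8aθ` with `(x + bs)² ≥ x²/2 - b²s²`. The smallness of `θ` leaves the
coefficient `B + 1`, one more than the growth to be beaten. -/
theorem growth_barrier_lower_bound {a b θ B x s : ℝ} (ha : 0 < a)
    (hθB : 16 * a * θ * (B + 1) ≤ 1) (hs : s ∈ Ioo 0 θ) :
    (B + 1) * x ^ 2 - b ^ 2 * θ / (8 * a) ≤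
      s / θ + (x + b * s) ^ 2 / (4 * a * (2 * θ - s)) := by
  have hθ : 0 < θ := hs.1.trans hs.2
  have h2 : 0 < 2 * θ - s := by linarith [hs.2, hs.1]
  have h1 : 0 ≤ s / θ := by have := hs.1; positivity
  have h3 : (x + b * s) ^ 2 / (8 * a * θ) ≤ (x + b * s) ^ 2 / (4 * a * (2 * θ - s)) := by
    refine div_le_div_of_nonneg_left (sq_nonneg _) (by positivity) ?_
    nlinarith [mul_pos ha hs.1]
  have h4 : (x ^ 2 / 2 - b ^ 2 * θ ^ 2) / (8 * a * θ) ≤ (x + b * s) ^ 2 / (8 * a * θ) := by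
    gcongr
    have : s ^ 2 ≤ θ ^ 2 := by
      have := hs.1.le
      gcongr
      exact hs.2.le
    nlinarith [sq_nonneg (x + 2 * b * s), mul_le_mul_of_nonneg_left this (sq_nonneg b)]
  have h5 : (x ^ 2 / 2 - b ^ 2 * θ ^ 2) / (8 * a * θ) =
      x ^ 2 / (16 * a * θ) - b ^ 2 * θ / (8 * a) := by
    field_simp; ring
  have h6 : (B + 1) * x ^ 2 ≤ x ^ 2 / (16 * a * θ) := by
    rw [le_div_iff₀ (by positivity)]
    nlinarith [mul_le_mul_of_nonneg_right hθB (sq_nonneg x)]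
  linarith

/-! ### Tychonoff uniqueness with an exceptional initial point -/

/-- Solutions of `u_s = a u_xx + b u_x` in the Tychonoff class with vanishing initial values,
except possibly at one point `x₀`, are nonpositive for a short time. -/
theorem HasPartials.nonpos_of_short_time {a b S A B θ x₀ : ℝ} {u us ux uxx : ℝ → ℝ → ℝ}
    (ha : 0 < a) (hA : 0 ≤ A) (hB : 0 ≤ B) (hθB : 16 * a * θ * (B + 1) ≤ 1)
    (hSθ : S ≤ θ) (hu : HasPartials (Ioo 0 S) u us ux uxx)
    (heq : ∀ x, ∀ s ∈ Ioo 0 S, us x s = a * uxx x s + b * ux x s)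
    (hinit : ∀ x, x ≠ x₀ → Tendsto (fun p : ℝ × ℝ => u p.1 p.2) (𝓝 x ×ˢ 𝓝[>] 0) (𝓝 0))
    (hgrowth : ∀ x, ∀ s ∈ Ioo 0 S, |u x s| ≤ A * Real.exp (B * x ^ 2)) :
    ∀ x, ∀ s ∈ Ioo 0 S, u x s ≤ 0 := by
  intro x s hs
  have hS : 0 < S := hs.1.trans hs.2
  have hθ : 0 < θ := hS.trans_le hSθ
  have hsub : Ioo 0 S ⊆ Ioo 0 θ := Ioo_subset_Ioo_right hSθ
  -- Lower bound for the kernel of width `ε` where `s < ε²` and `|x - x₀ + bs| ≤ 2ε`. As `M₀` bounds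
  -- `|u|` for `|x - x₀| ≤ 1`, the choice `M c = M₀ + 1` beats `u` near `x₀`.
  set c := Real.exp (-1 / a) / √2 with hc
  have hc0 : 0 < c := by positivity
  set M₀ := A * Real.exp (B * (|x₀| + 1) ^ 2) with hM₀
  set M := (M₀ + 1) / c with hM
  have hM0 : 0 < M := by positivity
  have hcomp : ∀ ε ∈ Ioc (0 : ℝ) 1, ∀ x, ∀ s ∈ Ioo 0 S,
      0 ≤ ε * Real.exp (s / θ + (x + b * s) ^ 2 / (4 * a * (2 * θ - s))) +
        M * (ε / √(s + ε ^ 2) * Real.exp (-(x - x₀ + b * s) ^ 2 / (4 * a * (s + ε ^ 2)))) +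
        -1 * u x s := by
    intro ε hε
    have hε0 := hε.1
    have hE1 : ∀ x, ∀ s ∈ Ioo 0 S,
        1 ≤ Real.exp (s / θ + (x + b * s) ^ 2 / (4 * a * (2 * θ - s))) := by
      intro x s hs
      have h1 := (hsub hs).1
      have : 0 < 2 * θ - s := by linarith [(hsub hs).2]
      exact Real.one_le_exp (by positivity)
    -- For `|x| ≥ R ≥ 1` one has `x² ≥ R`, so with `C = b²θ/(8a)`, `e^{x² - C} ≥ 1 + x² - C > A/ε`.
    -- This lets the barrier exceed the growth bound of `u`.
    refine HasPartials.nonneg_of_strict_supersolution (b := b)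
      (R := 1 + |b ^ 2 * θ / (8 * a)| + A / ε) ha.le
      ((((hasPartials_growth_barrier (b := b) ha).mono hsub).const_mul ε).add
        (((hasPartials_heat_kernel (b := b) (x₀ := x₀) ha hε0).mono
          (fun s hs => hs.1)).const_mul M) |>.add (hu.const_mul (-1))) ?_ ?_ ?_
    · intro x s hs
      have h2 : 0 < 2 * θ - s := by linarith [(hsub hs).2, hs.1]
      have h3 : 0 < s + ε ^ 2 := by have := hs.1; positivity
      have hE := hE1 x s hs
      have hlt : 1 / (2 * (2 * θ - s)) < 1 / θ := by
        apply one_div_lt_one_div_of_lt hθ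
        linarith [(hsub hs).2]
      rw [heq x s hs]
      generalize Real.exp (s / θ + (x + b * s) ^ 2 / (4 * a * (2 * θ - s))) = E at hE ⊢
      generalize ε / √(s + ε ^ 2) *
        Real.exp (-(x - x₀ + b * s) ^ 2 / (4 * a * (s + ε ^ 2))) = W
      have hpos : 0 < ε * E * (1 / θ - 1 / (2 * (2 * θ - s))) :=
        mul_pos (by positivity) (by linarith)
      rw [← sub_pos]
      refine hpos.trans_eq ?_
      have e1 : ε * (E * (1 / θ + b * (x + b * s) / (2 * a * (2 * θ - s)) +
          (x + b * s) ^ 2 / (4 * a * (2 * θ - s) ^ 2))) -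
          a * (ε * (E * (((x + b * s) / (2 * a * (2 * θ - s))) ^ 2 +
            1 / (2 * a * (2 * θ - s))))) -
          b * (ε * (E * ((x + b * s) / (2 * a * (2 * θ - s))))) =
          ε * E * (1 / θ - 1 / (2 * (2 * θ - s))) := by
        have := h2.ne'
        generalize 2 * θ - s = D at this
        field_simp; ring
      have e2 : W * (-1 / (2 * (s + ε ^ 2)) - b * (x - x₀ + b * s) / (2 * a * (s + ε ^ 2)) +
          (x - x₀ + b * s) ^ 2 / (4 * a * (s + ε ^ 2) ^ 2)) -
          a * (W * (((x - x₀ + b * s) / (2 * a * (s + ε ^ 2))) ^ 2 -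
            1 / (2 * a * (s + ε ^ 2)))) -
          b * (W * (-(x - x₀ + b * s) / (2 * a * (s + ε ^ 2)))) = 0 := by
        have := h3.ne'
        field_simp; ring
      linear_combination -e1 - M * e2
    · intro y
      have hS' : ∀ᶠ p : ℝ × ℝ in 𝓝 y ×ˢ 𝓝[>] 0, p.2 ∈ Ioo 0 S :=
        tendsto_snd.eventually (Ioo_mem_nhdsGT hS)
      rcases eq_or_ne y x₀ with rfl | hy
      · have h1 : ∀ᶠ p : ℝ × ℝ in 𝓝 y ×ˢ 𝓝[>] 0, p.1 ∈ Ioo (y - ε) (y + ε) :=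
          tendsto_fst.eventually (Ioo_mem_nhds (by linarith) (by linarith))
        have h2 : ∀ᶠ p : ℝ × ℝ in 𝓝 y ×ˢ 𝓝[>] 0, p.2 ∈ Ioo 0 (min (ε ^ 2) (ε / (|b| + 1))) :=
          tendsto_snd.eventually (Ioo_mem_nhdsGT (by positivity))
        filter_upwards [hS', h1, h2] with p hp hp1 hp2
        obtain ⟨hs0, hs1⟩ := hp2
        obtain ⟨hs1, hs2⟩ := lt_min_iff.1 hs1
        have hb : |b * p.2| ≤ ε := by
          rw [abs_mul, abs_of_pos hs0]
          rw [lt_div_iff₀ (by positivity)] at hs2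
          nlinarith
        have hd : |p.1 - y| < ε := abs_lt.2 ⟨by linarith [hp1.1], by linarith [hp1.2]⟩
        have hsq : (p.1 - y + b * p.2) ^ 2 ≤ 4 * ε ^ 2 := by
          have : |p.1 - y + b * p.2| ≤ 2 * ε := (abs_add_le _ _).trans (by linarith)
          calc _ = |p.1 - y + b * p.2| ^ 2 := (sq_abs _).symm
            _ ≤ (2 * ε) ^ 2 := by gcongr
            _ = _ := by ring
        have hW : c ≤ ε / √(p.2 + ε ^ 2) *
            Real.exp (-(p.1 - y + b * p.2) ^ 2 / (4 * a * (p.2 + ε ^ 2))) := by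
          have e1 : 1 / √2 ≤ ε / √(p.2 + ε ^ 2) := by
            have : √(p.2 + ε ^ 2) ≤ √2 * ε := by
              rw [← Real.sqrt_sq hε0.le, ← Real.sqrt_mul (by norm_num), Real.sqrt_sq hε0.le]
              exact Real.sqrt_le_sqrt (by linarith)
            rw [div_le_div_iff₀ (by positivity) (by positivity)]
            linarith
          have e2 : -1 / a ≤ -(p.1 - y + b * p.2) ^ 2 / (4 * a * (p.2 + ε ^ 2)) := by
            rw [div_le_div_iff₀ ha (by positivity)]
            nlinarith [mul_le_mul_of_nonneg_right hsq ha.le, mul_pos ha hs0]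
          calc c = 1 / √2 * Real.exp (-1 / a) := by rw [hc]; ring
            _ ≤ _ := by gcongr
        have hy1 : |p.1| ≤ |y| + 1 := by
          have := abs_sub_abs_le_abs_sub p.1 y
          linarith [hε.2]
        have hub : |u p.1 p.2| ≤ M₀ := by
          refine (hgrowth _ _ hp).trans ?_
          rw [hM₀, ← sq_abs p.1]
          gcongr
        have hMc : M * c = M₀ + 1 := by rw [hM]; field_simp
        have := mul_le_mul_of_nonneg_left hW hM0.le
        have := mul_le_mul_of_nonneg_left (hE1 p.1 p.2 hp) hε0.le
        linarith [le_abs_self (u p.1 p.2)]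
      · have h := (hinit y hy).eventually (gt_mem_nhds hε0)
        filter_upwards [hS', h] with p hp hlt
        have := mul_le_mul_of_nonneg_left (hE1 p.1 p.2 hp) hε0.le
        have hW : 0 ≤ M * (ε / √(p.2 + ε ^ 2) *
            Real.exp (-(p.1 - x₀ + b * p.2) ^ 2 / (4 * a * (p.2 + ε ^ 2)))) := by positivity
        linarith
    · intro x hx s hs
      have h0 := growth_barrier_lower_bound (b := b) (x := x) ha hθB (hsub hs)
      have hW : 0 ≤ M * (ε / √(s + ε ^ 2) *
          Real.exp (-(x - x₀ + b * s) ^ 2 / (4 * a * (s + ε ^ 2)))) := by positivity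
      set C := b ^ 2 * θ / (8 * a)
      have hx2 : 1 + |C| + A / ε ≤ x ^ 2 := by
        have h1 : 1 ≤ 1 + |C| + A / ε := by
          have : 0 ≤ |C| + A / ε := by positivity
          linarith
        rw [← sq_abs]
        nlinarith
      have hexp : A / ε < Real.exp (x ^ 2 - C) := by
        have := Real.add_one_le_exp (x ^ 2 - C)
        linarith [le_abs_self C]
      have hE : Real.exp (B * x ^ 2) * Real.exp (x ^ 2 - C) ≤
          Real.exp (s / θ + (x + b * s) ^ 2 / (4 * a * (2 * θ - s))) := by
        rw [← Real.exp_add]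
        exact Real.exp_le_exp.2 (by linarith)
      have h5 : A * Real.exp (B * x ^ 2) < ε *
          Real.exp (s / θ + (x + b * s) ^ 2 / (4 * a * (2 * θ - s))) := by
        rw [div_lt_iff₀ hε0] at hexp
        have := mul_lt_mul_of_pos_right hexp (Real.exp_pos (B * x ^ 2))
        nlinarith
      linarith [le_abs_self (u x s), hgrowth x s hs]
  -- At a fixed point with `s > 0` the kernel is at most `ε/√s`, so the whole comparison function
  -- tends to zero with `ε`.
  have hlim : Tendsto (fun ε : ℝ => ε *
      (Real.exp (s / θ + (x + b * s) ^ 2 / (4 * a * (2 * θ - s))) + M / √s))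
      (𝓝[>] 0) (𝓝 0) := by
    have : Tendsto (fun ε : ℝ => ε *
        (Real.exp (s / θ + (x + b * s) ^ 2 / (4 * a * (2 * θ - s))) + M / √s))
        (𝓝 0) (𝓝 (0 * _)) := tendsto_id.mul_const _
    rw [zero_mul] at this
    exact this.mono_left nhdsWithin_le_nhds
  refine ge_of_tendsto hlim ?_
  filter_upwards [Ioc_mem_nhdsGT (zero_lt_one' ℝ)] with ε hε
  have h := hcomp ε hε x s hs
  have hε0 := hε.1
  have hs0 := hs.1
  have hW : ε / √(s + ε ^ 2) * Real.exp (-(x - x₀ + b * s) ^ 2 / (4 * a * (s + ε ^ 2))) ≤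
      ε / √s * 1 := by
    gcongr
    · linarith [sq_nonneg ε]
    · rw [Real.exp_le_one_iff, neg_div]
      have : 0 ≤ (x - x₀ + b * s) ^ 2 / (4 * a * (s + ε ^ 2)) := by positivity
      linarith
  have := mul_le_mul_of_nonneg_left hW hM0.le
  have e : M * (ε / √s * 1) = ε * (M / √s) := by ring
  linarith

/-- Uniqueness in the Tychonoff class for `u_s = a u_xx + b u_x`, with one exceptional initial
point. -/
theorem HasPartials.eq_zero {a b S A B x₀ : ℝ} {u us ux uxx : ℝ → ℝ → ℝ}
    (ha : 0 < a) (hu : HasPartials (Ioo 0 S) u us ux uxx)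
    (heq : ∀ x, ∀ s ∈ Ioo 0 S, us x s = a * uxx x s + b * ux x s)
    (hinit : ∀ x, x ≠ x₀ → Tendsto (fun p : ℝ × ℝ => u p.1 p.2) (𝓝 x ×ˢ 𝓝[>] 0) (𝓝 0))
    (hgrowth : ∀ x, ∀ s ∈ Ioo 0 S, |u x s| ≤ A * Real.exp (B * x ^ 2)) :
    ∀ x, ∀ s ∈ Ioo 0 S, u x s = 0 := by
  obtain ⟨A', hA', B', hB', hgrowth'⟩ : ∃ A', 0 ≤ A' ∧ ∃ B', 0 ≤ B' ∧
      ∀ x, ∀ s ∈ Ioo 0 S, |u x s| ≤ A' * Real.exp (B' * x ^ 2) := by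
    refine ⟨|A|, abs_nonneg A, |B|, abs_nonneg B, fun x s hs => (hgrowth x s hs).trans ?_⟩
    gcongr
    · exact le_abs_self A
    · exact le_abs_self B
  set θ := 1 / (16 * a * (B' + 1)) with hθdef
  have hθ : 0 < θ := by positivity
  have hθB : 16 * a * θ * (B' + 1) ≤ 1 := by
    rw [hθdef]; apply le_of_eq; field_simp
  -- The length `θ` depends only on `a` and the growth exponent, so the short-time result, applied
  -- to `u` and `-u`, can be restarted at any time `c` with zero data.
  have step : ∀ c, 0 ≤ c → c < S →
      (∀ x, x ≠ x₀ → Tendsto (fun p : ℝ × ℝ => u p.1 (c + p.2)) (𝓝 x ×ˢ 𝓝[>] 0) (𝓝 0)) →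
      ∀ x, ∀ s ∈ Ioo 0 S, c < s → s < c + θ → u x s = 0 := by
    intro c hc hcS hc0 x s hs h1 h2
    have hmem : ∀ s ∈ Ioo 0 (min (S - c) θ), c + s ∈ Ioo 0 S := fun s hs =>
      ⟨by linarith [hs.1], by linarith [hs.2.trans_le (min_le_left _ _)]⟩
    have hs' : s - c ∈ Ioo 0 (min (S - c) θ) :=
      ⟨by linarith, lt_min (by linarith [hs.2]) (by linarith)⟩
    have hv := hu.shift c hmem
    have le1 := hv.nonpos_of_short_time (b := b) (x₀ := x₀) ha hA' hB' hθB (min_le_right _ _)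
      (fun x s hs => heq x _ (hmem s hs)) hc0 (fun x s hs => hgrowth' x _ (hmem s hs)) x _ hs'
    have le2 := (hv.const_mul (-1)).nonpos_of_short_time (b := b) (x₀ := x₀) ha hA' hB' hθB
      (min_le_right _ _)
      (fun x s hs => by rw [heq x _ (hmem s hs)]; ring)
      (fun x hx => by simpa using (hc0 x hx).const_mul (-1))
      (fun x s hs => by simpa using hgrowth' x _ (hmem s hs)) x _ hs'
    simp only [add_sub_cancel] at le1 le2
    linarith
  have key : ∀ n : ℕ, ∀ x, ∀ s ∈ Ioo 0 S, s < (n + 1) * θ → u x s = 0 := by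
    intro n
    induction n with
    | zero =>
      intro x s hs h
      exact step 0 le_rfl (hs.1.trans hs.2) (by simpa using hinit) x s hs hs.1
        (by simpa using h)
    | succ n ih =>
      intro x s hs h
      push_cast at h
      set c := ((n : ℝ) + 1) * θ with hc
      have hc0 : 0 < c := by positivity
      rcases lt_or_ge s c with hsc | hcs
      · exact ih x s hs hsc
      have hcS : c ∈ Ioo 0 S := ⟨hc0, hcs.trans_lt hs.2⟩
      -- At a positive time `c` continuity of `u` supplies zero data at every point, so no
      -- exceptional point survives the restart.
      have hcat : ∀ x, ContinuousAt (fun p : ℝ × ℝ => u p.1 p.2) (x, c) := fun x =>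
        hu.cont.continuousAt (prod_mem_nhds univ_mem (isOpen_Ioo.mem_nhds hcS))
      have hzero : ∀ x, u x c = 0 := by
        intro x
        have h1 : Tendsto (fun s => u x s) (𝓝[<] c) (𝓝 (u x c)) :=
          (hu.time x c hcS).continuousAt.mono_left nhdsWithin_le_nhds
        have h2 : Tendsto (fun s => u x s) (𝓝[<] c) (𝓝 0) := by
          refine tendsto_const_nhds.congr' ?_
          filter_upwards [Ioo_mem_nhdsLT hc0] with s hs
          exact (ih x s ⟨hs.1, hs.2.trans hcS.2⟩ hs.2).symm
        exact tendsto_nhds_unique h1 h2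
      rcases hcs.eq_or_lt with h1 | h1
      · rw [← h1]; exact hzero x
      refine step c hc0.le hcS.2 ?_ x s hs h1 (by rw [hc]; linarith)
      intro x _
      have h2 : Tendsto (fun p : ℝ × ℝ => (p.1, c + p.2)) (𝓝 x ×ˢ 𝓝[>] 0) (𝓝 (x, c)) := by
        have : Tendsto (fun p : ℝ × ℝ => (p.1, c + p.2)) (𝓝 (x, 0)) (𝓝 (x, c + 0)) :=
          Continuous.tendsto (by fun_prop) (x, (0 : ℝ))
        rw [add_zero, nhds_prod_eq] at this
        exact this.mono_left (prod_mono_right _ nhdsWithin_le_nhds)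
      have h3 := (hcat x).tendsto.comp h2
      rw [hzero] at h3
      exact h3
  intro x s hs
  obtain ⟨n, hn⟩ := exists_nat_gt (s / θ)
  refine key n x s hs ?_
  rw [div_lt_iff₀ hθ] at hn
  linarith

/-! ### Uniqueness for the Black–Scholes problem -/

/-- Logarithmic price, time to maturity and the factor `e^{rs}` make the coefficients constant and
remove the zeroth-order term. -/
theorem IsSolution.exists_hasPartials_log {r q σ T : ℝ} {f : ℝ → ℝ} {V : ℝ → ℝ → ℝ}
    (hV : IsSolution r q σ T f V) :
    ∃ us ux uxx, HasPartials (Ioo 0 T)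
        (fun x s => Real.exp (r * s) * V (Real.exp x) (T - s)) us ux uxx ∧
      ∀ x, ∀ s ∈ Ioo 0 T, us x s = σ ^ 2 / 2 * uxx x s + (r - q - σ ^ 2 / 2) * ux x s := by
  obtain ⟨Vt, VX, VXX, -, -, -, h⟩ := hV.equation
  have hmem : ∀ s ∈ Ioo 0 T, T - s ∈ Ioo 0 T := fun s hs =>
    ⟨by linarith [hs.2], by linarith [hs.1]⟩
  refine ⟨fun x s => Real.exp (r * s) * (r * V (Real.exp x) (T - s) - Vt (Real.exp x) (T - s)),
    fun x s => Real.exp (r * s) * (VX (Real.exp x) (T - s) * Real.exp x),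
    fun x s => Real.exp (r * s) * (VXX (Real.exp x) (T - s) * Real.exp x * Real.exp x +
      VX (Real.exp x) (T - s) * Real.exp x), ⟨?_, ?_, ?_, ?_⟩, ?_⟩
  · refine ContinuousOn.mul (by fun_prop) ?_
    exact hV.continuousOn.comp (f := fun p : ℝ × ℝ => (Real.exp p.1, T - p.2)) (by fun_prop)
      fun p hp => ⟨Real.exp_pos _, hmem _ hp.2⟩
  · intro x s hs
    have h1 := (h _ (Real.exp_pos x) _ (hmem s hs)).1
    have h2 : HasDerivAt (fun s => V (Real.exp x) (T - s)) (-Vt (Real.exp x) (T - s)) s :=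
      h1.comp_const_sub T s
    have h3 : HasDerivAt (fun s => Real.exp (r * s)) (Real.exp (r * s) * r) s :=
      ((hasDerivAt_id' s).const_mul r).exp.congr_deriv (by simp)
    exact (h3.fun_mul h2).congr_deriv (by ring)
  · intro x s hs
    have h1 := (h _ (Real.exp_pos x) _ (hmem s hs)).2.1
    exact (h1.comp x (Real.hasDerivAt_exp x)).const_mul _
  · intro x s hs
    have h1 := (h _ (Real.exp_pos x) _ (hmem s hs)).2.2.1
    exact ((h1.comp x (Real.hasDerivAt_exp x)).mul (Real.hasDerivAt_exp x)).const_mul _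
  · intro x s hs
    have h1 := (h _ (Real.exp_pos x) _ (hmem s hs)).2.2.2
    dsimp only
    linear_combination -Real.exp (r * s) * h1

/-- Uniqueness for payoffs with at most one point of discontinuity. -/
theorem IsSolution.eq_of_continuousAt {r q σ T K : ℝ} {f : ℝ → ℝ} {V W : ℝ → ℝ → ℝ}
    (hσ : 0 < σ) (hf : ∀ X ∈ Ioi (0 : ℝ), X ≠ K → ContinuousAt f X)
    (hV : IsSolution r q σ T f V) (hW : IsSolution r q σ T f W) :
    ∀ X ∈ Ioi (0 : ℝ), ∀ t ∈ Ioo 0 T, W X t = V X t := by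
  obtain ⟨us, ux, uxx, hu, hueq⟩ := hV.exists_hasPartials_log
  obtain ⟨ws, wx, wxx, hw, hweq⟩ := hW.exists_hasPartials_log
  obtain ⟨A₁, B₁, h₁⟩ := hV.growth
  obtain ⟨A₂, B₂, h₂⟩ := hW.growth
  have hmem : ∀ s ∈ Ioo 0 T, T - s ∈ Ioo 0 T := fun s hs =>
    ⟨by linarith [hs.2], by linarith [hs.1]⟩
  -- For `K = 0` the default `Real.log 0 = 0` merely exempts one more harmless point.
  have key := (hw.add (hu.const_mul (-1))).eq_zero (a := σ ^ 2 / 2) (b := r - q - σ ^ 2 / 2)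
    (A := Real.exp (|r| * T) * (|A₁| + |A₂|)) (B := max B₁ B₂) (x₀ := Real.log K)
    (by positivity) ?_ ?_ ?_
  · intro X hX t ht
    have h := key (Real.log X) (T - t) (hmem t ht)
    rw [Real.exp_log hX, sub_sub_cancel] at h
    have : Real.exp (r * (T - t)) * (W X t - V X t) = 0 := by linear_combination h
    rcases mul_eq_zero.1 this with h | h
    · exact absurd h (Real.exp_pos _).ne'
    · linarith
  · intro x s hs
    rw [hueq x s hs, hweq x s hs]; ring
  · intro x hx
    have hxK : Real.exp x ≠ K := by
      rintro rfl
      exact hx (Real.log_exp x).symm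
    have hc := hf _ (Real.exp_pos x) hxK
    have hlim : Tendsto (fun p : ℝ × ℝ => (Real.exp p.1, T - p.2)) (𝓝 x ×ˢ 𝓝[>] 0)
        (𝓝 (Real.exp x) ×ˢ 𝓝[<] T) := by
      refine Tendsto.prodMap (f := Real.exp) (g := fun s => T - s)
        (Real.continuous_exp.tendsto x) ?_
      refine tendsto_nhdsWithin_of_tendsto_nhds_of_eventually_within _ ?_ ?_
      · have : Tendsto (fun s : ℝ => T - s) (𝓝 0) (𝓝 (T - 0)) :=
          Continuous.tendsto (by fun_prop) 0
        rw [sub_zero] at this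
        exact this.mono_left nhdsWithin_le_nhds
      · filter_upwards [self_mem_nhdsWithin] with s hs
        have : 0 < s := hs
        show T - s < T
        linarith
    have hexp : Tendsto (fun p : ℝ × ℝ => Real.exp (r * p.2)) (𝓝 x ×ˢ 𝓝[>] 0) (𝓝 1) := by
      have : Tendsto (fun s : ℝ => Real.exp (r * s)) (𝓝 0) (𝓝 (Real.exp (r * 0))) :=
        Continuous.tendsto (by fun_prop) 0
      rw [mul_zero, Real.exp_zero] at this
      exact (this.mono_left nhdsWithin_le_nhds).comp tendsto_snd
    have h1 := (hV.terminal _ (Real.exp_pos x) hc).comp hlim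
    have h2 := (hW.terminal _ (Real.exp_pos x) hc).comp hlim
    have h3 := (hexp.mul h2).add ((hexp.mul h1).const_mul (-1))
    have e : 1 * f (Real.exp x) + -1 * (1 * f (Real.exp x)) = 0 := by ring
    rw [e] at h3
    exact h3
  · intro x s hs
    have hb : ∀ A B v : ℝ, |v| ≤ A * Real.exp (B * Real.log (Real.exp x) ^ 2) →
        B ≤ max B₁ B₂ → |v| ≤ |A| * Real.exp (max B₁ B₂ * x ^ 2) := by
      intro A B v hv hB
      rw [Real.log_exp] at hv
      refine hv.trans ?_
      gcongr
      exact le_abs_self A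
    have e1 := hb _ _ _ (h₁ _ (Real.exp_pos x) _ (hmem s hs)) (le_max_left _ _)
    have e2 := hb _ _ _ (h₂ _ (Real.exp_pos x) _ (hmem s hs)) (le_max_right _ _)
    have e3 : Real.exp (r * s) ≤ Real.exp (|r| * T) := by
      have h1 := hs.1.le
      apply Real.exp_le_exp.2
      calc r * s ≤ |r| * s := by gcongr; exact le_abs_self r
        _ ≤ |r| * T := by gcongr; exact hs.2.le
    calc |Real.exp (r * s) * W (Real.exp x) (T - s) +
          -1 * (Real.exp (r * s) * V (Real.exp x) (T - s))|
        = Real.exp (r * s) * |W (Real.exp x) (T - s) - V (Real.exp x) (T - s)| := by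
          rw [← abs_of_pos (Real.exp_pos (r * s)), ← abs_mul, abs_of_pos (Real.exp_pos (r * s))]
          congr 1; ring
      _ ≤ Real.exp (|r| * T) * (|W (Real.exp x) (T - s)| + |V (Real.exp x) (T - s)|) := by
          gcongr
          exact abs_sub _ _
      _ ≤ Real.exp (|r| * T) * (|A₂| * Real.exp (max B₁ B₂ * x ^ 2) +
            |A₁| * Real.exp (max B₁ B₂ * x ^ 2)) := by gcongr
      _ = _ := by ring

/-! ### Exponential moments and differentiation under the integral -/

/-- The exponential moments `∫ w^k F(w) exp(p w - s w²) dw`. -/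
noncomputable def moment (F : ℝ → ℝ) (k : ℕ) (p s : ℝ) : ℝ :=
  ∫ w, w ^ k * F w * Real.exp (p * w - s * w ^ 2)

/-- From `|w|^k ≤ k! e^{|w|}` and completing the square. The bound is uniform in `(p, s)`, hence
serves as the dominating function for differentiation. -/
theorem abs_pow_mul_exp_le {p s P s₀ : ℝ} (k : ℕ) (w : ℝ) (hs₀ : 0 < s₀) (hp : |p| ≤ P)
    (hs : s₀ / 2 ≤ s) :
    |w| ^ k * Real.exp (p * w - s * w ^ 2) ≤
      k.factorial * Real.exp ((P + 1) ^ 2 / s₀) * Real.exp (-(s₀ / 4) * w ^ 2) := by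
  have h1 : |w| ^ k ≤ k.factorial * Real.exp |w| := by
    have := Real.pow_div_factorial_le_exp |w| (abs_nonneg w) k
    rwa [div_le_iff₀ (by positivity), mul_comm] at this
  have h2 : p * w ≤ P * |w| := by
    calc p * w ≤ |p * w| := le_abs_self _
      _ = |p| * |w| := abs_mul _ _
      _ ≤ P * |w| := by gcongr
  have h3 : (P + 1) * |w| ≤ (P + 1) ^ 2 / s₀ + s₀ / 4 * w ^ 2 := by
    have e : (P + 1) ^ 2 / s₀ + s₀ / 4 * w ^ 2 - (P + 1) * |w| =
        ((P + 1) - s₀ / 2 * |w|) ^ 2 / s₀ := by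
      rw [← sq_abs w]; field_simp; ring
    have : 0 ≤ ((P + 1) - s₀ / 2 * |w|) ^ 2 / s₀ := by positivity
    linarith
  calc |w| ^ k * Real.exp (p * w - s * w ^ 2)
      ≤ k.factorial * Real.exp |w| * Real.exp (p * w - s * w ^ 2) := by gcongr
    _ = k.factorial * Real.exp (|w| + (p * w - s * w ^ 2)) := by
        rw [Real.exp_add]; ring
    _ ≤ k.factorial * Real.exp ((P + 1) ^ 2 / s₀ + -(s₀ / 4) * w ^ 2) := by
        refine mul_le_mul_of_nonneg_left (Real.exp_le_exp.2 ?_) (by positivity)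
        nlinarith [mul_le_mul_of_nonneg_right hs (sq_nonneg w)]
    _ = _ := by rw [Real.exp_add]; ring

theorem integrable_moment {F : ℝ → ℝ} (hF : Measurable F) (hF1 : ∀ w, |F w| ≤ 1) (k : ℕ)
    (p : ℝ) {s : ℝ} (hs : 0 < s) :
    Integrable fun w => w ^ k * F w * Real.exp (p * w - s * w ^ 2) := by
  refine Integrable.mono' ((integrable_exp_neg_mul_sq (b := s / 4) (by positivity)).const_mul
    (k.factorial * Real.exp ((|p| + 1) ^ 2 / s))) (by fun_prop) (ae_of_all _ fun w => ?_)
  have h := abs_pow_mul_exp_le k w hs le_rfl (by linarith : s / 2 ≤ s) (p := p)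
  refine le_trans ?_ h
  rw [norm_mul, norm_mul, norm_pow, Real.norm_eq_abs, Real.norm_eq_abs, Real.norm_eq_abs,
    Real.abs_exp]
  gcongr
  exact mul_le_of_le_one_right (by positivity) (hF1 w)

/-- Differentiating the exponential in `p` brings down `w`, and in `s` brings down `-w²`. The joint
derivative gives both joint continuity and the chain rule along curves. -/
theorem hasFDerivAt_moment {F : ℝ → ℝ} (hF : Measurable F) (hF1 : ∀ w, |F w| ≤ 1) (k : ℕ)
    (p : ℝ) {s : ℝ} (hs : 0 < s) :
    HasFDerivAt (fun z : ℝ × ℝ => moment F k z.1 z.2)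
      (moment F (k + 1) p s • ContinuousLinearMap.fst ℝ ℝ ℝ -
        moment F (k + 2) p s • ContinuousLinearMap.snd ℝ ℝ ℝ) (p, s) := by
  set F' : ℝ × ℝ → ℝ → ℝ × ℝ →L[ℝ] ℝ := fun z w =>
    (w ^ (k + 1) * F w * Real.exp (z.1 * w - z.2 * w ^ 2)) • ContinuousLinearMap.fst ℝ ℝ ℝ -
      (w ^ (k + 2) * F w * Real.exp (z.1 * w - z.2 * w ^ 2)) • ContinuousLinearMap.snd ℝ ℝ ℝ
    with hF'
  have hint : ∫ w, F' (p, s) w = moment F (k + 1) p s • ContinuousLinearMap.fst ℝ ℝ ℝ -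
        moment F (k + 2) p s • ContinuousLinearMap.snd ℝ ℝ ℝ := by
    simp only [hF', moment]
    rw [integral_sub ((integrable_moment hF hF1 _ p hs).smul_const _)
      ((integrable_moment hF hF1 _ p hs).smul_const _), integral_smul_const, integral_smul_const]
  rw [← hint]
  have hnhds : {z : ℝ × ℝ | |z.1| < |p| + 1 ∧ s / 2 < z.2} ∈ 𝓝 (p, s) := by
    refine IsOpen.mem_nhds ?_ ⟨by simp, by simpa using hs⟩
    exact (isOpen_lt (f := fun z : ℝ × ℝ => |z.1|) (by fun_prop) continuous_const).inter
      (isOpen_lt (f := fun _ : ℝ × ℝ => s / 2) continuous_const continuous_snd)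
  refine hasFDerivAt_integral_of_dominated_of_fderiv_le (bound := fun w =>
    ((k + 1).factorial + (k + 2).factorial) * Real.exp ((|p| + 1 + 1) ^ 2 / s) *
      Real.exp (-(s / 4) * w ^ 2)) hnhds (Eventually.of_forall fun z => by fun_prop)
    (integrable_moment hF hF1 k p hs) ?_ (ae_of_all _ fun w z hz => ?_)
    ((integrable_exp_neg_mul_sq (by positivity)).const_mul _) (ae_of_all _ fun w z hz => ?_)
  · exact ((integrable_moment hF hF1 _ p hs).smul_const _).aestronglyMeasurable.sub
      ((integrable_moment hF hF1 _ p hs).smul_const _).aestronglyMeasurable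
  · have hb : ∀ j : ℕ, ‖w ^ j * F w * Real.exp (z.1 * w - z.2 * w ^ 2)‖ ≤
        j.factorial * Real.exp ((|p| + 1 + 1) ^ 2 / s) * Real.exp (-(s / 4) * w ^ 2) := by
      intro j
      refine le_trans ?_ (abs_pow_mul_exp_le j w hs hz.1.le hz.2.le)
      rw [norm_mul, norm_mul, norm_pow, Real.norm_eq_abs, Real.norm_eq_abs, Real.norm_eq_abs,
        Real.abs_exp]
      gcongr
      exact mul_le_of_le_one_right (by positivity) (hF1 w)
    refine (norm_sub_le _ _).trans ?_
    rw [norm_smul, norm_smul]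
    have h1 := mul_le_mul (hb (k + 1)) (ContinuousLinearMap.norm_fst_le ℝ ℝ ℝ) (norm_nonneg _)
      (by positivity)
    have h2 := mul_le_mul (hb (k + 2)) (ContinuousLinearMap.norm_snd_le ℝ ℝ ℝ) (norm_nonneg _)
      (by positivity)
    refine (add_le_add h1 h2).trans_eq ?_
    ring
  · have h1 : HasFDerivAt (fun z : ℝ × ℝ => z.1 * w - z.2 * w ^ 2)
        (w • ContinuousLinearMap.fst ℝ ℝ ℝ - w ^ 2 • ContinuousLinearMap.snd ℝ ℝ ℝ) z :=
      (hasFDerivAt_fst.mul_const w).sub (hasFDerivAt_snd.mul_const (w ^ 2))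
    refine (h1.exp.const_mul (w ^ k * F w)).congr_fderiv ?_
    ext <;> simp [hF'] <;> ring

theorem continuousAt_moment {F : ℝ → ℝ} (hF : Measurable F) (hF1 : ∀ w, |F w| ≤ 1) (k : ℕ)
    (p : ℝ) {s : ℝ} (hs : 0 < s) :
    ContinuousAt (fun z : ℝ × ℝ => moment F k z.1 z.2) (p, s) :=
  (hasFDerivAt_moment hF hF1 k p hs).continuousAt

theorem HasDerivAt.moment {F : ℝ → ℝ} (hF : Measurable F) (hF1 : ∀ w, |F w| ≤ 1) (k : ℕ)
    {p s : ℝ → ℝ} {p' s' t : ℝ} (hst : 0 < s t) (hp : HasDerivAt p p' t)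
    (hs : HasDerivAt s s' t) :
    HasDerivAt (fun t => moment F k (p t) (s t))
      (moment F (k + 1) (p t) (s t) * p' - moment F (k + 2) (p t) (s t) * s') t :=
  (HasFDerivAt.comp_hasDerivAt (f := fun t => (p t, s t)) t
    (hasFDerivAt_moment hF hF1 k (p t) hst) (hp.prodMk hs)).congr_deriv (by simp)

/-! ### Gaussian means and the heat equation -/

/-- `E[F(y + κ Z)]` for a standard normal variable `Z`. -/
noncomputable def gaussianMean (F : ℝ → ℝ) (y κ : ℝ) : ℝ :=
  (√(2 * Real.pi))⁻¹ * ∫ z, Real.exp (-z ^ 2 / 2) * F (y + κ * z)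

theorem integrable_exp_neg_sq_div_two : Integrable fun z : ℝ => Real.exp (-z ^ 2 / 2) := by
  convert integrable_exp_neg_mul_sq (b := 1 / 2) (by norm_num) using 3
  ring

theorem integral_exp_neg_sq_div_two : ∫ z : ℝ, Real.exp (-z ^ 2 / 2) = √(2 * Real.pi) := by
  have h := integral_gaussian (1 / 2)
  rw [show Real.pi / (1 / 2) = 2 * Real.pi by ring] at h
  rw [← h]
  congr 1 with z
  congr 1
  ring

theorem abs_gaussianMean_le_one {F : ℝ → ℝ} (hF1 : ∀ w, |F w| ≤ 1) (y κ : ℝ) :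
    |gaussianMean F y κ| ≤ 1 := by
  have hpi : 0 < √(2 * Real.pi) := by positivity
  rw [gaussianMean, abs_mul, abs_of_pos (by positivity), inv_mul_le_iff₀ hpi, mul_one,
    ← integral_exp_neg_sq_div_two, ← Real.norm_eq_abs]
  refine norm_integral_le_of_norm_le integrable_exp_neg_sq_div_two (ae_of_all _ fun z => ?_)
  rw [norm_mul, Real.norm_eq_abs, Real.norm_eq_abs, Real.abs_exp]
  exact mul_le_of_le_one_right (Real.exp_pos _).le (hF1 _)

theorem gaussianMean_neg (F : ℝ → ℝ) (y κ : ℝ) : gaussianMean F y (-κ) = gaussianMean F y κ := by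
  unfold gaussianMean
  rw [← integral_neg_eq_self]
  simp

theorem gaussianMean_zero (F : ℝ → ℝ) (y : ℝ) : gaussianMean F y 0 = F y := by
  have hpi : √(2 * Real.pi) ≠ 0 := by positivity
  simp only [gaussianMean, zero_mul, add_zero]
  rw [integral_mul_const, integral_exp_neg_sq_div_two, inv_mul_cancel_left₀ hpi]

/-- Dominated convergence. It yields the terminal condition at continuity points of the payoff. -/
theorem continuousAt_gaussianMean_zero {F : ℝ → ℝ} (hF : Measurable F) (hF1 : ∀ w, |F w| ≤ 1)
    {y : ℝ} (hy : ContinuousAt F y) :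
    ContinuousAt (fun p : ℝ × ℝ => gaussianMean F p.1 p.2) (y, 0) := by
  unfold gaussianMean
  refine continuousAt_const.mul ?_
  refine continuousAt_of_dominated (bound := fun z => Real.exp (-z ^ 2 / 2))
    (Eventually.of_forall fun p => by fun_prop)
    (Eventually.of_forall fun p => ae_of_all _ fun z => ?_) integrable_exp_neg_sq_div_two
    (ae_of_all _ fun z => ?_)
  · rw [norm_mul, Real.norm_eq_abs, Real.norm_eq_abs, Real.abs_exp]
    exact mul_le_of_le_one_right (Real.exp_pos _).le (hF1 _)
  · refine continuousAt_const.mul (ContinuousAt.comp (f := fun p : ℝ × ℝ => p.1 + p.2 * z) ?_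
      (by fun_prop))
    simpa using hy

/-- The substitution `w = y + κz` moves `y` and `κ` from the argument of `F` into the exponential,
so smoothness needs no regularity of `F` beyond measurability. -/
theorem gaussianMean_eq_moment (F : ℝ → ℝ) (y : ℝ) {κ : ℝ} (hκ : 0 < κ) :
    gaussianMean F y κ = (√(2 * Real.pi) * κ)⁻¹ * Real.exp (-y ^ 2 / (2 * κ ^ 2)) *
      moment F 0 (y / κ ^ 2) (1 / (2 * κ ^ 2)) := by
  have h1 : ∫ z, Real.exp (-z ^ 2 / 2) * F (y + κ * z) =
      κ⁻¹ * ∫ w, Real.exp (-((w - y) / κ) ^ 2 / 2) * F w := by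
    have e1 := Measure.integral_comp_mul_left
      (fun v => Real.exp (-(v / κ) ^ 2 / 2) * F (y + v)) κ
    have e2 := integral_add_left_eq_self (μ := volume)
      (fun w => Real.exp (-((w - y) / κ) ^ 2 / 2) * F w) y
    rw [abs_of_pos (inv_pos.2 hκ), smul_eq_mul] at e1
    rw [← e2]
    simp only [add_sub_cancel_left]
    rw [← e1]
    congr 1 with z
    rw [mul_div_cancel_left₀ _ hκ.ne']
  have h2 : ∫ w, Real.exp (-((w - y) / κ) ^ 2 / 2) * F w =
      Real.exp (-y ^ 2 / (2 * κ ^ 2)) * moment F 0 (y / κ ^ 2) (1 / (2 * κ ^ 2)) := by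
    rw [moment, ← integral_const_mul]
    refine integral_congr_ae (ae_of_all _ fun w => ?_)
    dsimp only
    rw [show -((w - y) / κ) ^ 2 / 2 = -y ^ 2 / (2 * κ ^ 2) +
      (y / κ ^ 2 * w - 1 / (2 * κ ^ 2) * w ^ 2) by field_simp; ring, Real.exp_add]
    ring
  rw [gaussianMean, h1, h2, mul_inv]
  ring

/-- The Gaussian mean of bounded measurable initial values solves the heat equation with drift. -/
theorem exists_hasPartials_gaussianMean {F : ℝ → ℝ} (hF : Measurable F) (hF1 : ∀ w, |F w| ≤ 1)
    {σ : ℝ} (hσ : 0 < σ) (d : ℝ) :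
    ∃ us ux uxx : ℝ → ℝ → ℝ,
      HasPartials (Ioi 0) (fun x s => gaussianMean F (x + d * s) (σ * √s)) us ux uxx ∧
      ContinuousOn (fun p : ℝ × ℝ => us p.1 p.2) (univ ×ˢ Ioi 0) ∧
      ContinuousOn (fun p : ℝ × ℝ => ux p.1 p.2) (univ ×ˢ Ioi 0) ∧
      ContinuousOn (fun p : ℝ × ℝ => uxx p.1 p.2) (univ ×ˢ Ioi 0) ∧
      ∀ x, ∀ s ∈ Ioi (0 : ℝ), us x s = σ ^ 2 / 2 * uxx x s + d * ux x s := by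
  -- The mean is `Q · M 0`. Its derivatives are `Q` times combinations of `M 0`, `M 1`, `M 2`, so
  -- the equation becomes an algebraic identity.
  set Q : ℝ → ℝ → ℝ := fun x s =>
    (√(2 * Real.pi) * (σ * √s))⁻¹ * Real.exp (-(x + d * s) ^ 2 / (2 * (σ ^ 2 * s))) with hQ
  set M : ℕ → ℝ → ℝ → ℝ := fun k x s =>
    moment F k ((x + d * s) / (σ ^ 2 * s)) (1 / (2 * (σ ^ 2 * s))) with hM
  have hu : ∀ x, ∀ s ∈ Ioi (0 : ℝ),
      gaussianMean F (x + d * s) (σ * √s) = Q x s * M 0 x s := by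
    intro x s hs
    have hs0 : 0 < s := hs
    have e : (σ * √s) ^ 2 = σ ^ 2 * s := by rw [mul_pow, Real.sq_sqrt hs0.le]
    rw [gaussianMean_eq_moment F _ (by positivity), e]
  have hQx : ∀ x, ∀ s ∈ Ioi (0 : ℝ),
      HasDerivAt (fun x => Q x s) (Q x s * (-(x + d * s) / (σ ^ 2 * s))) x := by
    intro x s hs
    have hs0 : 0 < s := hs
    have h : HasDerivAt (fun x => -(x + d * s) ^ 2 / (2 * (σ ^ 2 * s)))
        (-(x + d * s) / (σ ^ 2 * s)) x :=
      ((((hasDerivAt_id' x).add_const (d * s)).fun_pow 2).fun_neg.div_const _).congr_deriv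
        (by field_simp; norm_num; ring)
    exact (h.exp.const_mul _).congr_deriv (by rw [hQ]; ring)
  have hQs : ∀ x, ∀ s ∈ Ioi (0 : ℝ), HasDerivAt (fun s => Q x s)
      (Q x s * (-1 / (2 * s) + (x + d * s) ^ 2 / (2 * σ ^ 2 * s ^ 2) -
        d * (x + d * s) / (σ ^ 2 * s))) s := by
    intro x s hs
    have hs0 : 0 < s := hs
    have hq : √s ^ 2 = s := Real.sq_sqrt hs0.le
    have hpi : √(2 * Real.pi) ≠ 0 := by positivity
    have h1 : HasDerivAt (fun s => -(x + d * s) ^ 2) (-(2 * (x + d * s) * d)) s :=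
      ((((hasDerivAt_id' s).const_mul d).const_add x).fun_pow 2).fun_neg.congr_deriv (by simp)
    have h2 : HasDerivAt (fun s => 2 * (σ ^ 2 * s)) (2 * σ ^ 2) s :=
      (((hasDerivAt_id' s).const_mul (σ ^ 2)).const_mul 2).congr_deriv (by ring)
    have h3 : HasDerivAt (fun s => (√(2 * Real.pi) * (σ * √s))⁻¹)
        ((√(2 * Real.pi) * (σ * √s))⁻¹ * (-1 / (2 * s))) s :=
      (((((hasDerivAt_id' s).sqrt hs0.ne').const_mul σ).const_mul
        (√(2 * Real.pi))).fun_inv (by positivity)).congr_deriv (by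
          rw [mul_pow, mul_pow, hq]; field_simp)
    exact (h3.fun_mul (h1.fun_div h2 (by positivity)).exp).congr_deriv
      (by rw [hQ]; field_simp; ring)
  have hMx : ∀ k x, ∀ s ∈ Ioi (0 : ℝ),
      HasDerivAt (fun x => M k x s) (M (k + 1) x s / (σ ^ 2 * s)) x := by
    intro k x s hs
    have hs0 : 0 < s := hs
    exact (HasDerivAt.moment (p := fun x => (x + d * s) / (σ ^ 2 * s))
      (s := fun _ => 1 / (2 * (σ ^ 2 * s))) hF hF1 k (by positivity)
      (((hasDerivAt_id' x).add_const (d * s)).div_const _) (hasDerivAt_const _ _)).congr_deriv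
      (by simp only [hM]; ring)
  have hMs : ∀ k x, ∀ s ∈ Ioi (0 : ℝ), HasDerivAt (fun s => M k x s)
      (M (k + 1) x s * (d / (σ ^ 2 * s) - (x + d * s) / (σ ^ 2 * s ^ 2)) +
        M (k + 2) x s / (2 * σ ^ 2 * s ^ 2)) s := by
    intro k x s hs
    have hs0 : 0 < s := hs
    have h2 : HasDerivAt (fun s => σ ^ 2 * s) (σ ^ 2) s :=
      ((hasDerivAt_id' s).const_mul (σ ^ 2)).congr_deriv (by ring)
    have h1 : HasDerivAt (fun s => (x + d * s) / (σ ^ 2 * s))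
        (d / (σ ^ 2 * s) - (x + d * s) / (σ ^ 2 * s ^ 2)) s :=
      ((((hasDerivAt_id' s).const_mul d).const_add x).fun_div h2 (by positivity)).congr_deriv
        (by field_simp)
    have h3 : HasDerivAt (fun s => 1 / (2 * (σ ^ 2 * s))) (-1 / (2 * σ ^ 2 * s ^ 2)) s :=
      ((hasDerivAt_const s (1 : ℝ)).fun_div (h2.const_mul 2) (by positivity)).congr_deriv
        (by field_simp; ring)
    exact (HasDerivAt.moment (p := fun s => (x + d * s) / (σ ^ 2 * s))
      (s := fun s => 1 / (2 * (σ ^ 2 * s))) hF hF1 k (by positivity) h1 h3).congr_deriv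
      (by simp only [hM]; ring)
  have hne : ∀ p ∈ (univ : Set ℝ) ×ˢ Ioi (0 : ℝ), p.2 ≠ 0 := fun p hp => (ne_of_gt hp.2)
  have hQc : ContinuousOn (fun p : ℝ × ℝ => Q p.1 p.2) (univ ×ˢ Ioi 0) := by
    have h1 : ∀ p ∈ (univ : Set ℝ) ×ˢ Ioi (0 : ℝ), √(2 * Real.pi) * (σ * √p.2) ≠ 0 := by
      intro p hp
      have : 0 < p.2 := hp.2
      positivity
    have h2 : ∀ p ∈ (univ : Set ℝ) ×ˢ Ioi (0 : ℝ), 2 * (σ ^ 2 * p.2) ≠ 0 := by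
      intro p hp
      have : 0 < p.2 := hp.2
      positivity
    rw [hQ]
    fun_prop (disch := assumption)
  have hMc : ∀ k, ContinuousOn (fun p : ℝ × ℝ => M k p.1 p.2) (univ ×ˢ Ioi 0) := by
    intro k p hp
    have hs0 : 0 < p.2 := hp.2
    have h1 : σ ^ 2 * p.2 ≠ 0 := by positivity
    have h2 : 2 * (σ ^ 2 * p.2) ≠ 0 := by positivity
    refine ContinuousAt.continuousWithinAt ?_
    exact ContinuousAt.comp (f := fun p : ℝ × ℝ =>
      ((p.1 + d * p.2) / (σ ^ 2 * p.2), 1 / (2 * (σ ^ 2 * p.2))))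
      (continuousAt_moment hF hF1 k _ (by positivity)) (by fun_prop (disch := assumption))
  have hσ2 : ∀ p ∈ (univ : Set ℝ) ×ˢ Ioi (0 : ℝ), σ ^ 2 * p.2 ≠ 0 := fun p hp =>
    mul_ne_zero (by positivity) (hne p hp)
  have hσ3 : ∀ p ∈ (univ : Set ℝ) ×ˢ Ioi (0 : ℝ), σ ^ 2 * p.2 ^ 2 ≠ 0 := fun p hp =>
    mul_ne_zero (by positivity) (pow_ne_zero 2 (hne p hp))
  have hσ4 : ∀ p ∈ (univ : Set ℝ) ×ˢ Ioi (0 : ℝ), 2 * σ ^ 2 * p.2 ^ 2 ≠ 0 := fun p hp =>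
    mul_ne_zero (by positivity) (pow_ne_zero 2 (hne p hp))
  have h2p : ∀ p ∈ (univ : Set ℝ) ×ˢ Ioi (0 : ℝ), 2 * p.2 ≠ 0 := fun p hp =>
    mul_ne_zero two_ne_zero (hne p hp)
  refine ⟨fun x s => Q x s * (-1 / (2 * s) + (x + d * s) ^ 2 / (2 * σ ^ 2 * s ^ 2) -
        d * (x + d * s) / (σ ^ 2 * s)) * M 0 x s + Q x s *
      (M 1 x s * (d / (σ ^ 2 * s) - (x + d * s) / (σ ^ 2 * s ^ 2)) +
        M 2 x s / (2 * σ ^ 2 * s ^ 2)),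
    fun x s => Q x s * (-(x + d * s) / (σ ^ 2 * s)) * M 0 x s +
      Q x s * (M 1 x s / (σ ^ 2 * s)),
    fun x s => (Q x s * (-(x + d * s) / (σ ^ 2 * s)) * (-(x + d * s) / (σ ^ 2 * s)) +
        Q x s * (-1 / (σ ^ 2 * s))) * M 0 x s +
      Q x s * (-(x + d * s) / (σ ^ 2 * s)) * (M 1 x s / (σ ^ 2 * s)) +
      (Q x s * (-(x + d * s) / (σ ^ 2 * s)) * (M 1 x s / (σ ^ 2 * s)) +
        Q x s * (M 2 x s / (σ ^ 2 * s) / (σ ^ 2 * s))),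
    ⟨?_, ?_, ?_, ?_⟩, ?_, ?_, ?_, ?_⟩
  · exact (hQc.mul (hMc 0)).congr fun p hp => hu _ _ hp.2
  · intro x s hs
    refine ((hQs x s hs).mul (hMs 0 x s hs)).congr_of_eventuallyEq ?_
    filter_upwards [Ioi_mem_nhds hs] with s' hs'
    exact hu x s' hs'
  · intro x s hs
    refine ((hQx x s hs).mul (hMx 0 x s hs)).congr_of_eventuallyEq (Eventually.of_forall ?_)
    intro x'
    exact hu x' s hs
  · intro x s hs
    have h : HasDerivAt (fun x => -(x + d * s) / (σ ^ 2 * s)) (-1 / (σ ^ 2 * s)) x :=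
      ((hasDerivAt_id' x).add_const (d * s)).fun_neg.div_const _
    exact (((hQx x s hs).fun_mul h).fun_mul (hMx 0 x s hs)).fun_add
      ((hQx x s hs).fun_mul ((hMx 1 x s hs).div_const _))
  · have h0 := hMc 0
    have h1 := hMc 1
    have h2 := hMc 2
    clear_value Q M
    fun_prop (disch := assumption)
  · have h0 := hMc 0
    have h1 := hMc 1
    have h2 := hMc 2
    clear_value Q M
    fun_prop (disch := assumption)
  · have h0 := hMc 0
    have h1 := hMc 1
    have h2 := hMc 2
    clear_value Q M
    fun_prop (disch := assumption)
  · intro x s hs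
    have hs0 : 0 < s := hs
    clear_value Q M
    field_simp
    ring

/-! ### Existence for the Black–Scholes problem -/

/-- The discounted Gaussian mean of `F` solves the Black–Scholes terminal value problem with payoff
`X^β F(log X)`. -/
theorem isSolution_of_eq_gaussianMean {r q σ T β : ℝ} {F f : ℝ → ℝ} {V : ℝ → ℝ → ℝ}
    (hσ : 0 < σ) (hT : 0 < T) (hF : Measurable F) (hF1 : ∀ w, |F w| ≤ 1)
    (hf : ∀ X ∈ Ioi (0 : ℝ), f X = X ^ β * F (Real.log X))
    (hV : ∀ X ∈ Ioi (0 : ℝ), ∀ t ∈ Ioo 0 T, V X t = X ^ β * Real.exp (mu r q σ β * (T - t)) *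
      gaussianMean F (Real.log X + (r - q - σ ^ 2 / 2 + σ ^ 2 * β) * (T - t)) (σ * √(T - t))) :
    IsSolution r q σ T f V := by
  -- Factoring out `X^β` adds `σ²β` to the drift and produces the zeroth-order coefficient `μ(β)`.
  set d := r - q - σ ^ 2 / 2 + σ ^ 2 * β with hd
  obtain ⟨us, ux, uxx, hu, husc, huxc, huxxc, heq⟩ :=
    exists_hasPartials_gaussianMean hF hF1 hσ d
  set u : ℝ → ℝ → ℝ := fun x s => gaussianMean F (x + d * s) (σ * √s) with hudef
  have hV' : ∀ X ∈ Ioi (0 : ℝ), ∀ t ∈ Ioo 0 T,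
      V X t = X ^ β * Real.exp (mu r q σ β * (T - t)) * u (Real.log X) (T - t) := hV
  clear_value u
  have hmem : ∀ t ∈ Ioo 0 T, T - t ∈ Ioi (0 : ℝ) := fun t ht => by
    show 0 < T - t
    linarith [ht.2]
  have hne : ∀ p ∈ Ioi (0 : ℝ) ×ˢ Ioo 0 T, p.1 ≠ 0 := fun p hp => ne_of_gt hp.1
  have hcomp : ∀ g : ℝ → ℝ → ℝ, ContinuousOn (fun p : ℝ × ℝ => g p.1 p.2) (univ ×ˢ Ioi 0) →
      ContinuousOn (fun p : ℝ × ℝ => g (Real.log p.1) (T - p.2)) (Ioi 0 ×ˢ Ioo 0 T) :=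
    fun g hg => hg.comp (f := fun p : ℝ × ℝ => (Real.log p.1, T - p.2))
      (by fun_prop (disch := assumption)) fun p hp => ⟨mem_univ _, hmem _ hp.2⟩
  have hpow : ContinuousOn (fun p : ℝ × ℝ => p.1 ^ β * Real.exp (mu r q σ β * (T - p.2)))
      (Ioi 0 ×ˢ Ioo 0 T) :=
    (continuousOn_fst.rpow_const fun p hp => Or.inl (hne p hp)).mul (by fun_prop)
  have hc0 := hcomp _ hu.cont
  have hcs := hcomp _ husc
  have hcx := hcomp _ huxc
  have hcxx := hcomp _ huxxc
  have hlog : ∀ X ∈ Ioi (0 : ℝ), HasDerivAt Real.log X⁻¹ X := fun X hX =>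
    Real.hasDerivAt_log (ne_of_gt hX)
  have hrpow : ∀ X ∈ Ioi (0 : ℝ), HasDerivAt (fun X => X ^ β) (X ^ β * (β / X)) X := by
    intro X hX
    refine (Real.hasDerivAt_rpow_const (Or.inl (ne_of_gt hX))).congr_deriv ?_
    rw [Real.rpow_sub_one (ne_of_gt hX)]; ring
  refine ⟨(hpow.mul hc0).congr fun p hp => hV' _ hp.1 _ hp.2, ?_, ?_, ?_⟩
  · refine ⟨fun X t => X ^ β * Real.exp (mu r q σ β * (T - t)) *
        (-mu r q σ β * u (Real.log X) (T - t) - us (Real.log X) (T - t)),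
      fun X t => X ^ β * Real.exp (mu r q σ β * (T - t)) *
        ((β * u (Real.log X) (T - t) + ux (Real.log X) (T - t)) / X),
      fun X t => X ^ β * Real.exp (mu r q σ β * (T - t)) *
        ((β * (β - 1) * u (Real.log X) (T - t) + (2 * β - 1) * ux (Real.log X) (T - t) +
          uxx (Real.log X) (T - t)) / X ^ 2), ?_, ?_, ?_, ?_⟩
    · exact hpow.mul ((hc0.const_mul _).sub hcs)
    · exact hpow.mul (((hc0.const_mul _).add hcx).div continuousOn_fst hne)
    · exact hpow.mul ((((hc0.const_mul _).add (hcx.const_mul _)).add hcxx).div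
        (continuousOn_fst.pow 2) fun p hp => pow_ne_zero 2 (hne p hp))
    · intro X hX t ht
      have hX0 : 0 < X := hX
      have ht' := hmem t ht
      have h1 := hu.space (Real.log X) _ ht'
      have h1' : HasDerivAt (fun X => u (Real.log X) (T - t))
        (ux (Real.log X) (T - t) * X⁻¹) X := h1.comp X (hlog X hX)
      have h2 := hu.space₂ (Real.log X) _ ht'
      have h2' : HasDerivAt (fun X => ux (Real.log X) (T - t))
        (uxx (Real.log X) (T - t) * X⁻¹) X := h2.comp X (hlog X hX)
      have hp : HasDerivAt (fun X => X ^ β * Real.exp (mu r q σ β * (T - t)))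
          (X ^ β * (β / X) * Real.exp (mu r q σ β * (T - t))) X := (hrpow X hX).mul_const _
      refine ⟨?_, ?_, ?_, ?_⟩
      · have h3 : HasDerivAt (fun t => u (Real.log X) (T - t)) (-us (Real.log X) (T - t)) t :=
          (hu.time (Real.log X) _ ht').comp_const_sub T t
        have h4 : HasDerivAt (fun t => Real.exp (mu r q σ β * (T - t)))
            (Real.exp (mu r q σ β * (T - t)) * (-mu r q σ β)) t :=
          (((hasDerivAt_id' t).const_sub T).const_mul _).exp.congr_deriv (by simp)
        refine (((h4.const_mul (X ^ β)).fun_mul h3).congr_deriv ?_).congr_of_eventuallyEq ?_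
        · ring
        · filter_upwards [Ioo_mem_nhds ht.1 ht.2] with t' ht'
          exact hV' X hX t' ht'
      · refine ((hp.fun_mul h1').congr_deriv ?_).congr_of_eventuallyEq ?_
        · ring
        · filter_upwards [Ioi_mem_nhds hX] with X' hX'
          exact hV' X' hX' t ht
      · exact (hp.fun_mul (((h1'.const_mul β).fun_add h2').fun_div (hasDerivAt_id' X)
          hX0.ne')).congr_deriv (by field_simp; ring)
      · rw [hV' X hX t ht]
        simp only [heq _ _ ht', mu, hd]
        field_simp
        ring
  · intro X hX hfX
    have hX0 : 0 < X := hX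
    have hFc : ContinuousAt F (Real.log X) := by
      have e : F = fun w => f (Real.exp w) * (Real.exp w ^ β)⁻¹ := by
        funext w
        have := Real.rpow_pos_of_pos (Real.exp_pos w) β
        rw [hf _ (Real.exp_pos w), Real.log_exp]
        field_simp
      rw [e]
      refine ContinuousAt.mul ?_ (ContinuousAt.inv₀ ?_ ?_)
      · refine ContinuousAt.comp ?_ Real.continuous_exp.continuousAt
        rwa [Real.exp_log hX0]
      · exact Real.continuous_exp.continuousAt.rpow_const (Or.inl (Real.exp_pos _).ne')
      · exact (Real.rpow_pos_of_pos (Real.exp_pos _) β).ne'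
    have hG := continuousAt_gaussianMean_zero hF hF1 hFc
    have hlim : Tendsto (fun p : ℝ × ℝ => (Real.log p.1 + d * (T - p.2), σ * √(T - p.2)))
        (𝓝 (X, T)) (𝓝 (Real.log X, 0)) := by
      have : ContinuousAt (fun p : ℝ × ℝ => (Real.log p.1 + d * (T - p.2), σ * √(T - p.2)))
          (X, T) := by
        have : (X, T).1 ≠ 0 := hX0.ne'
        fun_prop (disch := assumption)
      simpa [ContinuousAt] using this
    have hpre : Tendsto (fun p : ℝ × ℝ => p.1 ^ β * Real.exp (mu r q σ β * (T - p.2)))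
        (𝓝 (X, T)) (𝓝 (X ^ β)) := by
      have : ContinuousAt (fun p : ℝ × ℝ => p.1 ^ β * Real.exp (mu r q σ β * (T - p.2)))
          (X, T) :=
        (continuousAt_fst.rpow_const (Or.inl hX0.ne')).mul (by fun_prop)
      simpa [ContinuousAt] using this
    have h := hpre.mul (hG.tendsto.comp hlim)
    rw [nhds_prod_eq] at h
    have h := h.mono_left (prod_mono_right (𝓝 X) (nhdsWithin_le_nhds (s := Iio T)))
    rw [gaussianMean_zero, ← hf X hX] at h
    refine h.congr' ?_
    filter_upwards [prod_mem_prod (Ioi_mem_nhds hX0) (Ioo_mem_nhdsLT hT)] with p hp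
    exact (hV _ hp.1 _ hp.2).symm
  · refine ⟨Real.exp (|mu r q σ β| * T + β ^ 2), 1, fun X hX t ht => ?_⟩
    have hX0 : 0 < X := hX
    have h0 : 0 < T - t := hmem t ht
    rw [hV X hX t ht, abs_mul, Real.rpow_def_of_pos hX0, ← Real.exp_add, ← Real.exp_add,
      Real.abs_exp]
    refine (mul_le_of_le_one_right (Real.exp_pos _).le (abs_gaussianMean_le_one hF1 _ _)).trans ?_
    apply Real.exp_le_exp.2
    have h1 : mu r q σ β * (T - t) ≤ |mu r q σ β| * T := by
      calc mu r q σ β * (T - t) ≤ |mu r q σ β| * (T - t) := by gcongr; exact le_abs_self _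
        _ ≤ |mu r q σ β| * T := by gcongr; linarith [ht.1]
    nlinarith [sq_nonneg (2 * β - Real.log X), sq_nonneg (Real.log X)]

/-! ### Extended-real values of δ and continuity of the payoff -/

theorem delta_div_zero {r q σ Y θ₁ θ₂ θ₃ : ℝ} (hσ : 0 < σ) (hY : 0 < Y) (hθ₃ : 0 < θ₃) :
    delta r q σ (ENNReal.ofReal Y / ENNReal.ofReal 0) θ₁ θ₂ θ₃ = ⊤ := by
  have h : ENNReal.ofReal Y ≠ 0 := by simpa using hY
  rw [delta, ENNReal.ofReal_zero, ENNReal.div_zero h, ENNReal.log_top, EReal.top_add_coe,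
    EReal.top_div_of_pos_ne_top (by exact_mod_cast (by positivity : 0 < σ * √θ₃))
      (EReal.coe_ne_top _)]

theorem delta_div_ofReal {r q σ Y L θ₁ θ₂ θ₃ : ℝ} (hY : 0 < Y) (hL : 0 < L) :
    delta r q σ (ENNReal.ofReal Y / ENNReal.ofReal L) θ₁ θ₂ θ₃ =
      (((Real.log Y - Real.log L + ((r - q - σ ^ 2 / 2) * θ₁ + σ ^ 2 * θ₂)) / (σ * √θ₃) : ℝ) :
        EReal) := by
  rw [delta, ← ENNReal.ofReal_div_of_pos hL, ENNReal.log_ofReal_of_pos (by positivity),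
    Real.log_div hY.ne' hL.ne', ← EReal.coe_add, EReal.coe_div]

/-- The premise `0 < L →` covers the case `L = 0`, where `δ = +∞` and there is no constraint. -/
theorem coe_le_delta_iff {r q σ Y L θ₁ θ₂ θ₃ t : ℝ} (hσ : 0 < σ) (hY : 0 < Y) (hL : 0 ≤ L)
    (hθ₃ : 0 < θ₃) :
    (t : EReal) ≤ delta r q σ (ENNReal.ofReal Y / ENNReal.ofReal L) θ₁ θ₂ θ₃ ↔
      (0 < L → t * (σ * √θ₃) ≤
        Real.log Y - Real.log L + ((r - q - σ ^ 2 / 2) * θ₁ + σ ^ 2 * θ₂)) := by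
  rcases hL.eq_or_lt with rfl | hL
  · rw [delta_div_zero hσ hY hθ₃]
    simp
  · rw [delta_div_ofReal hY hL, EReal.coe_le_coe_iff, le_div_iff₀ (by positivity)]
    simp [hL]

theorem delta_le_coe_iff {r q σ Y L θ₁ θ₂ θ₃ t : ℝ} (hσ : 0 < σ) (hY : 0 < Y) (hL : 0 ≤ L)
    (hθ₃ : 0 < θ₃) :
    delta r q σ (ENNReal.ofReal Y / ENNReal.ofReal L) θ₁ θ₂ θ₃ ≤ (t : EReal) ↔
      (0 < L ∧ Real.log Y - Real.log L + ((r - q - σ ^ 2 / 2) * θ₁ + σ ^ 2 * θ₂) ≤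
        t * (σ * √θ₃)) := by
  rcases hL.eq_or_lt with rfl | hL
  · rw [delta_div_zero hσ hY hθ₃]
    simp
  · rw [delta_div_ofReal hY hL, EReal.coe_le_coe_iff, div_le_iff₀ (by positivity)]
    simp [hL]

theorem measurableSet_coe_le (a : EReal) : MeasurableSet {y : ℝ | (y : EReal) ≤ a} :=
  measurableSet_le measurable_coe_real_ereal measurable_const

theorem abs_N_le_one (x : EReal) : |N x| ≤ 1 := by
  have hpi : 0 < √(2 * Real.pi) := by positivity
  have h0 : 0 ≤ ∫ t in {t : ℝ | (t : EReal) ≤ x}, Real.exp (-t ^ 2 / 2) :=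
    integral_nonneg fun t => (Real.exp_pos _).le
  rw [N, abs_of_nonneg (by positivity), inv_mul_le_iff₀ hpi, mul_one,
    ← integral_exp_neg_sq_div_two]
  exact setIntegral_le_integral integrable_exp_neg_sq_div_two
    (ae_of_all _ fun t => (Real.exp_pos _).le)

theorem continuous_N_coe : Continuous fun x : ℝ => N x := by
  have h : (fun x : ℝ => N x) = fun x : ℝ => (√(2 * Real.pi))⁻¹ *
      ((∫ t in Iic (0 : ℝ), Real.exp (-t ^ 2 / 2)) + ∫ t in (0 : ℝ)..x, Real.exp (-t ^ 2 / 2)) := by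
    funext x
    rw [← intervalIntegral.integral_Iic_sub_Iic integrable_exp_neg_sq_div_two.integrableOn
      integrable_exp_neg_sq_div_two.integrableOn, add_sub_cancel]
    simp only [N, EReal.coe_le_coe_iff]
    rfl
  rw [h]
  refine continuous_const.mul (continuous_const.add ?_)
  exact intervalIntegral.continuous_primitive
    (fun _ _ => integrable_exp_neg_sq_div_two.intervalIntegrable) 0

theorem continuousAt_N_delta {r q σ i L θ₁ θ₂ θ₃ X : ℝ} (hσ : 0 < σ) (hL : 0 ≤ L)
    (hθ₃ : 0 < θ₃) (hX : 0 < X) :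
    ContinuousAt (fun x : ℝ =>
      N (delta r q σ (ENNReal.ofReal (x ^ i) / ENNReal.ofReal L) θ₁ θ₂ θ₃)) X := by
  rcases hL.eq_or_lt with rfl | hL
  · refine (continuousAt_const (y := N ⊤)).congr ?_
    filter_upwards [Ioi_mem_nhds hX] with x hx
    rw [delta_div_zero hσ (Real.rpow_pos_of_pos hx i) hθ₃]
  · have h : ContinuousAt (fun x : ℝ => N (((Real.log (x ^ i) - Real.log L +
        ((r - q - σ ^ 2 / 2) * θ₁ + σ ^ 2 * θ₂)) / (σ * √θ₃) : ℝ) : EReal)) X := by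
      refine continuous_N_coe.continuousAt.comp (f := fun x : ℝ => (Real.log (x ^ i) -
        Real.log L + ((r - q - σ ^ 2 / 2) * θ₁ + σ ^ 2 * θ₂)) / (σ * √θ₃)) ?_
      have h1 : ContinuousAt (fun x : ℝ => Real.log (x ^ i)) X :=
        (continuousAt_id.rpow_const (Or.inl hX.ne')).log (Real.rpow_pos_of_pos hX i).ne'
      fun_prop
    refine h.congr ?_
    filter_upwards [Ioi_mem_nhds hX] with x hx
    rw [delta_div_ofReal (Real.rpow_pos_of_pos hx i) hL]

theorem continuousAt_payoff {r q σ β i L τ₁ τ₂ τ₃ X : ℝ} {A : Set ℝ} (hσ : 0 < σ) (hL : 0 ≤ L)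
    (hτ₃ : 0 < τ₃) (hX : 0 < X) (hA : A ∈ 𝓝 X ∨ Aᶜ ∈ 𝓝 X) :
    ContinuousAt (payoff r q σ β i L τ₁ τ₂ τ₃ A) X := by
  rcases hA with hA | hA
  · refine ((continuousAt_id.rpow_const (p := β) (Or.inl hX.ne')).mul
      (continuousAt_N_delta (r := r) (q := q) (i := i) (θ₁ := τ₁) (θ₂ := τ₂) hσ hL hτ₃
        hX)).congr ?_
    filter_upwards [hA] with x hx
    rw [payoff, indicator_of_mem hx]
    rfl
  · refine (continuousAt_const (y := (0 : ℝ))).congr ?_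
    filter_upwards [hA] with x hx
    rw [payoff, indicator_of_notMem hx]

/-! ### The bivariate normal distribution function -/

/-- The quadratic form minus `(1 - ρ²)(y₁² + y₂²)/2` is half the sum of the squares of `y₁ - ρy₂`
and `ρy₁ - y₂`, so `e^{-(y₁² + y₂²)/4}` dominates. -/
theorem integrable_bivariate {ρ : ℝ} (hρ : ρ ^ 2 < 1) :
    Integrable fun p : ℝ × ℝ =>
      Real.exp (-(p.1 ^ 2 - 2 * ρ * p.1 * p.2 + p.2 ^ 2) / (2 * (1 - ρ ^ 2))) := by
  have h1 : Integrable fun z : ℝ => Real.exp (-(1 / 4) * z ^ 2) :=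
    integrable_exp_neg_mul_sq (by norm_num)
  refine (h1.mul_prod h1).mono' (Continuous.aestronglyMeasurable (by fun_prop))
    (ae_of_all _ fun p => ?_)
  rw [Real.norm_eq_abs, Real.abs_exp, ← Real.exp_add]
  apply Real.exp_le_exp.2
  rw [div_le_iff₀ (by linarith)]
  nlinarith [sq_nonneg (p.1 - ρ * p.2), sq_nonneg (ρ * p.1 - p.2)]

/-- The bivariate normal distribution function as an iterated integral over independent
variables. -/
theorem N₂_eq_integral {a₁ a₂ : EReal} {ρ : ℝ} (hρ : ρ ^ 2 < 1) :
    N₂ a₁ a₂ ρ = (√(2 * Real.pi))⁻¹ * ∫ z in {z : ℝ | (z : EReal) ≤ a₂}, Real.exp (-z ^ 2 / 2) *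
      ((√(2 * Real.pi))⁻¹ *
        ∫ t in {t : ℝ | ((ρ * z + √(1 - ρ ^ 2) * t : ℝ) : EReal) ≤ a₁},
          Real.exp (-t ^ 2 / 2)) := by
  set c := √(1 - ρ ^ 2) with hc
  have hc0 : 0 < c := Real.sqrt_pos.2 (by linarith)
  have hc2 : c ^ 2 = 1 - ρ ^ 2 := Real.sq_sqrt (by linarith)
  -- Substituting `y = ρz + ct` turns the quadratic form into `c²(z² + t²)`; the Jacobian is the
  -- factor `c`.
  have hinner : ∀ z : ℝ, ∫ y in {y : ℝ | (y : EReal) ≤ a₁},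
      Real.exp (-(y ^ 2 - 2 * ρ * y * z + z ^ 2) / (2 * (1 - ρ ^ 2))) =
      c * (Real.exp (-z ^ 2 / 2) *
        ∫ t in {t : ℝ | ((ρ * z + c * t : ℝ) : EReal) ≤ a₁}, Real.exp (-t ^ 2 / 2)) := by
    intro z
    set g : ℝ → ℝ := {y : ℝ | (y : EReal) ≤ a₁}.indicator
      (fun y => Real.exp (-(y ^ 2 - 2 * ρ * y * z + z ^ 2) / (2 * (1 - ρ ^ 2)))) with hg
    have e1 := Measure.integral_comp_mul_left (fun v => g (ρ * z + v)) c
    have e2 := integral_add_left_eq_self (μ := volume) g (ρ * z)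
    rw [abs_of_pos (inv_pos.2 hc0), smul_eq_mul, e2] at e1
    have hms : MeasurableSet {t : ℝ | ((ρ * z + c * t : ℝ) : EReal) ≤ a₁} :=
      (measurableSet_coe_le a₁).preimage (f := fun t : ℝ => ρ * z + c * t) (by fun_prop)
    have e3 : ∫ t, g (ρ * z + c * t) = Real.exp (-z ^ 2 / 2) *
        ∫ t in {t : ℝ | ((ρ * z + c * t : ℝ) : EReal) ≤ a₁}, Real.exp (-t ^ 2 / 2) := by
      rw [← integral_const_mul, ← integral_indicator hms]
      refine integral_congr_ae (ae_of_all _ fun t => ?_)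
      simp only [hg, indicator, mem_ofPred_eq]
      split_ifs
      · rw [← Real.exp_add]
        congr 1
        rw [div_eq_iff (by linarith)]
        linear_combination (-t ^ 2) * hc2
      · rfl
    rw [← integral_indicator (measurableSet_coe_le a₁), ← hg, ← e3, e1]
    field_simp
  have hswap := integral_integral_swap (μ := volume.restrict {y : ℝ | (y : EReal) ≤ a₁})
    (ν := volume.restrict {y : ℝ | (y : EReal) ≤ a₂})
    (f := fun y₁ y₂ : ℝ =>
      Real.exp (-(y₁ ^ 2 - 2 * ρ * y₁ * y₂ + y₂ ^ 2) / (2 * (1 - ρ ^ 2)))) (by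
        rw [Measure.prod_restrict]
        exact (integrable_bivariate hρ).integrableOn)
  have hpi : √(2 * Real.pi) ^ 2 = 2 * Real.pi := Real.sq_sqrt (by positivity)
  have hinv : (2 * Real.pi * c)⁻¹ * c = (√(2 * Real.pi))⁻¹ * (√(2 * Real.pi))⁻¹ := by
    rw [mul_inv, mul_assoc, inv_mul_cancel₀ hc0.ne', mul_one, ← mul_inv, ← sq, hpi]
  rw [N₂, hswap]
  simp only [hinner]
  rw [integral_const_mul, ← hc, ← mul_assoc, hinv, mul_assoc, ← integral_const_mul]
  simp only [mul_left_comm]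

/-! ### The Gaussian mean of the payoff in closed form -/

/-- The payoff divided by `X^β`, as a function of `log X`. -/
noncomputable def logPayoff (r q σ i L τ₁ τ₂ τ₃ : ℝ) (A : Set ℝ) (w : ℝ) : ℝ :=
  A.indicator (fun x => N (delta r q σ (ENNReal.ofReal (x ^ i) / ENNReal.ofReal L) τ₁ τ₂ τ₃))
    (Real.exp w)

theorem measurable_logPayoff {r q σ i L τ₁ τ₂ τ₃ : ℝ} {A : Set ℝ} (hσ : 0 < σ) (hL : 0 ≤ L)
    (hτ₃ : 0 < τ₃) (hA : MeasurableSet A) : Measurable (logPayoff r q σ i L τ₁ τ₂ τ₃ A) := by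
  have h : Continuous fun w : ℝ =>
      N (delta r q σ (ENNReal.ofReal (Real.exp w ^ i) / ENNReal.ofReal L) τ₁ τ₂ τ₃) :=
    continuous_iff_continuousAt.2 fun w => ContinuousAt.comp (f := Real.exp)
      (continuousAt_N_delta hσ hL hτ₃ (Real.exp_pos w)) Real.continuous_exp.continuousAt
  exact h.measurable.indicator (hA.preimage Real.measurable_exp)

theorem abs_logPayoff_le_one {r q σ i L τ₁ τ₂ τ₃ : ℝ} {A : Set ℝ} (w : ℝ) :
    |logPayoff r q σ i L τ₁ τ₂ τ₃ A w| ≤ 1 := by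
  rw [logPayoff, indicator]
  split_ifs
  · exact abs_N_le_one _
  · simp

theorem payoff_eq_logPayoff {r q σ β i L τ₁ τ₂ τ₃ X : ℝ} {A : Set ℝ} (hX : 0 < X) :
    payoff r q σ β i L τ₁ τ₂ τ₃ A X =
      X ^ β * logPayoff r q σ i L τ₁ τ₂ τ₃ A (Real.log X) := by
  rw [payoff, logPayoff, Real.exp_log hX, indicator, indicator]
  split_ifs <;> simp

theorem rho_sq_lt_one {i τ₃ η ρ : ℝ} (hτ₃ : 0 < τ₃) (hρ : ρ * √(τ₃ + i ^ 2 * η ^ 2) = -(i * η)) :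
    ρ ^ 2 < 1 ∧ √(1 - ρ ^ 2) * √(τ₃ + i ^ 2 * η ^ 2) = √τ₃ := by
  have hR : 0 < τ₃ + i ^ 2 * η ^ 2 := by positivity
  have h : ρ ^ 2 * (τ₃ + i ^ 2 * η ^ 2) = i ^ 2 * η ^ 2 := by
    rw [← Real.sq_sqrt hR.le, ← mul_pow, hρ]; ring
  have h1 : ρ ^ 2 < 1 := by
    by_contra! h1
    nlinarith
  refine ⟨h1, ?_⟩
  rw [← Real.sqrt_mul (by linarith)]
  congr 1
  linarith

/-- Here `η = ±√τ`, with the sign free so that the event `A` can be written as a lower half-line in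
`z`. In `N[δ]` the log-price is multiplied by `i`: its drift supplies the shifts `iτ`, `iβτ` in
`a₁`, its noise `iσηz` moves to the side of `t`, and division by `σ√(τ₃ + i²η²)` gives `ρz + √(1 -
ρ²) t ≤ a₁`. Agreement almost everywhere suffices, so strict and weak inequalities need not be
distinguished. -/
theorem gaussianMean_logPayoff {r q σ β i L τ₁ τ₂ τ₃ X η ρ : ℝ} {A : Set ℝ} {a : EReal}
    (hσ : 0 < σ) (hL : 0 ≤ L) (hτ₃ : 0 < τ₃) (hX : 0 < X)
    (hρ : ρ * √(τ₃ + i ^ 2 * η ^ 2) = -(i * η))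
    (hA : ∀ᵐ z : ℝ, Real.exp (Real.log X + (r - q - σ ^ 2 / 2 + σ ^ 2 * β) * η ^ 2 +
      σ * η * z) ∈ A ↔ (z : EReal) ≤ a) :
    gaussianMean (logPayoff r q σ i L τ₁ τ₂ τ₃ A)
      (Real.log X + (r - q - σ ^ 2 / 2 + σ ^ 2 * β) * η ^ 2) (σ * η) =
      N₂ (BlackScholes.a₁ r q σ β i L τ₁ τ₂ τ₃ X (η ^ 2)) a ρ := by
  obtain ⟨hρ1, hR⟩ := rho_sq_lt_one hτ₃ hρ
  rw [N₂_eq_integral hρ1, gaussianMean, ← integral_indicator (measurableSet_coe_le a)]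
  congr 1
  refine integral_congr_ae ?_
  filter_upwards [hA] with z hz
  by_cases h : (z : EReal) ≤ a
  · have hset : {t : ℝ | (t : EReal) ≤ delta r q σ (ENNReal.ofReal
        (Real.exp (Real.log X + (r - q - σ ^ 2 / 2 + σ ^ 2 * β) * η ^ 2 + σ * η * z) ^ i) /
          ENNReal.ofReal L) τ₁ τ₂ τ₃} =
        {t : ℝ | ((ρ * z + √(1 - ρ ^ 2) * t : ℝ) : EReal) ≤
          BlackScholes.a₁ r q σ β i L τ₁ τ₂ τ₃ X (η ^ 2)} := by
      ext t
      rw [mem_ofPred_eq, mem_ofPred_eq, BlackScholes.a₁,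
        coe_le_delta_iff hσ (Real.rpow_pos_of_pos (Real.exp_pos _) i) hL hτ₃,
        coe_le_delta_iff hσ (Real.rpow_pos_of_pos hX i) hL (by positivity),
        Real.log_rpow (Real.exp_pos _), Real.log_exp, Real.log_rpow hX]
      have e : (ρ * z + √(1 - ρ ^ 2) * t) * (σ * √(τ₃ + i ^ 2 * η ^ 2)) =
          -(i * η) * z * σ + √τ₃ * t * σ := by
        rw [← hρ, ← hR]; ring
      rw [e]
      refine forall_congr' fun _ => ?_
      constructor <;> intro h <;> linarith
    rw [logPayoff, indicator_of_mem (hz.2 h), indicator_of_mem (by exact h), N, hset]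
  · rw [logPayoff, indicator_of_notMem fun h' => h (hz.1 h'),
      indicator_of_notMem (by exact h), mul_zero]

end BlackScholes

/-! ### The two payoffs -/

open BlackScholes
theorem theorem1 (r q σ T β i L K τ₁ τ₂ τ₃ : ℝ) (hσ : 0 < σ) (hT : 0 < T)
    (hL : 0 ≤ L) (hK : 0 ≤ K) (hτ₃ : 0 < τ₃) :
    -- the payoff with the indicator of `X > K` (upper sign of `± a₂`)
    IsTheSolution r q σ T (payoff r q σ β i L τ₁ τ₂ τ₃ (Ioi K))
      (fun X t => X ^ β * Real.exp (mu r q σ β * (T - t)) *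
        N₂ (a₁ r q σ β i L τ₁ τ₂ τ₃ X (T - t)) (a₂ r q σ β K X (T - t)) (rho i τ₃ (T - t))) ∧
    -- the payoff with the indicator of `X < K` (lower sign of `± a₂`)
    IsTheSolution r q σ T (payoff r q σ β i L τ₁ τ₂ τ₃ (Iio K))
      (fun X t => X ^ β * Real.exp (mu r q σ β * (T - t)) *
        N₂ (a₁ r q σ β i L τ₁ τ₂ τ₃ X (T - t)) (-a₂ r q σ β K X (T - t))
          (-rho i τ₃ (T - t))) := by
  have hunique : ∀ {A : Set ℝ} {V : ℝ → ℝ → ℝ}, (∀ X, X ≠ K → A ∈ 𝓝 X ∨ Aᶜ ∈ 𝓝 X) →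
      IsSolution r q σ T (payoff r q σ β i L τ₁ τ₂ τ₃ A) V →
      IsTheSolution r q σ T (payoff r q σ β i L τ₁ τ₂ τ₃ A) V := fun hA hV =>
    ⟨hV, fun W hW => hV.eq_of_continuousAt hσ
      (fun X hX hXK => continuousAt_payoff hσ hL hτ₃ hX (hA X hXK)) hW⟩
  have hrho : ∀ τ : ℝ, 0 < τ →
      rho i τ₃ τ * √(τ₃ + i ^ 2 * √τ ^ 2) = i * √τ := by
    intro τ hτ
    have hR : 0 < τ₃ + i ^ 2 * τ := by positivity
    have hR' : √(τ₃ + i ^ 2 * τ) ≠ 0 := by positivity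
    rw [Real.sq_sqrt hτ.le, rho, Real.sqrt_div hτ.le]
    field_simp
  -- The log-price hits `ln K` with probability zero, which reconciles the strict indicator with the
  -- weak inequality in `N₂`.
  have hne : ∀ y κ : ℝ, κ ≠ 0 → ∀ᵐ z : ℝ, y + κ * z ≠ Real.log K := by
    intro y κ hκ
    have : ∀ᵐ z : ℝ, z ≠ (Real.log K - y) / κ := by simp [ae_iff]
    filter_upwards [this] with z hz h
    apply hz
    rw [eq_div_iff hκ]
    linarith
  constructor
  · refine hunique (fun X hX => ?_) (isSolution_of_eq_gaussianMean hσ hT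
      (measurable_logPayoff hσ hL hτ₃ measurableSet_Ioi) abs_logPayoff_le_one
      (fun X hX => payoff_eq_logPayoff hX) fun X hX t ht => ?_)
    · rw [compl_Ioi]
      exact hX.lt_or_gt.symm.imp Ioi_mem_nhds Iic_mem_nhds
    · have hX0 : 0 < X := hX
      have hτ : 0 < T - t := by linarith [ht.2]
      have hsq : (-√(T - t)) ^ 2 = T - t := by rw [neg_sq, Real.sq_sqrt hτ.le]
      have hpos : 0 < √(T - t) := by positivity
      -- `X > K` is an upper half-line in the noise; reversing its sign, `η = -√τ`, makes it `z ≤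
      -- a₂` and the correlation `+ρ`. Evenness of the Gaussian removes the sign afterwards.
      have h := gaussianMean_logPayoff (r := r) (q := q) (β := β) (i := i) (τ₁ := τ₁) (τ₂ := τ₂)
        (X := X) (η := -√(T - t)) (ρ := rho i τ₃ (T - t)) (A := Ioi K)
        (a := a₂ r q σ β K X (T - t)) hσ hL hτ₃ hX0
        (by rw [neg_sq, hrho _ hτ]; ring) ?_
      · rw [hsq, mul_neg, gaussianMean_neg] at h
        rw [h]
      · rw [hsq]
        filter_upwards [hne (Real.log X + (r - q - σ ^ 2 / 2 + σ ^ 2 * β) * (T - t))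
          (σ * -√(T - t)) (mul_ne_zero hσ.ne' (neg_ne_zero.2 hpos.ne'))] with z hz
        rw [a₂, coe_le_delta_iff hσ hX0 hK hτ, mem_Ioi]
        rcases hK.eq_or_lt with rfl | hK
        · simp [Real.exp_pos]
        · rw [← Real.log_lt_iff_lt_exp hK]
          constructor
          · intro h _; linarith
          · intro h
            exact lt_of_le_of_ne (by linarith [h hK]) hz.symm
  · refine hunique (fun X hX => ?_) (isSolution_of_eq_gaussianMean hσ hT
      (measurable_logPayoff hσ hL hτ₃ measurableSet_Iio) abs_logPayoff_le_one
      (fun X hX => payoff_eq_logPayoff hX) fun X hX t ht => ?_)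
    · rw [compl_Iio]
      exact hX.lt_or_gt.imp Iio_mem_nhds Ici_mem_nhds
    · have hX0 : 0 < X := hX
      have hτ : 0 < T - t := by linarith [ht.2]
      have hsq : √(T - t) ^ 2 = T - t := Real.sq_sqrt hτ.le
      have hpos : 0 < √(T - t) := by positivity
      -- `X < K` is already a lower half-line, so `η = √τ`, with bound `-a₂` and correlation `-ρ`.
      have h := gaussianMean_logPayoff (r := r) (q := q) (β := β) (i := i) (τ₁ := τ₁) (τ₂ := τ₂)
        (X := X) (η := √(T - t)) (ρ := -rho i τ₃ (T - t)) (A := Iio K)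
        (a := -a₂ r q σ β K X (T - t)) hσ hL hτ₃ hX0
        (by rw [neg_mul, hrho _ hτ]) ?_
      · rw [hsq] at h
        rw [h]
      · rw [hsq]
        filter_upwards [hne (Real.log X + (r - q - σ ^ 2 / 2 + σ ^ 2 * β) * (T - t))
          (σ * √(T - t)) (mul_ne_zero hσ.ne' hpos.ne')] with z hz
        rw [EReal.le_neg, ← EReal.coe_neg, a₂, delta_le_coe_iff hσ hX0 hK hτ, mem_Iio]
        constructor
        · intro h
          have hK : 0 < K := (Real.exp_pos _).trans h
          rw [← Real.lt_log_iff_exp_lt hK] at h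
          exact ⟨hK, by linarith⟩
        · rintro ⟨hK, h⟩
          rw [← Real.lt_log_iff_exp_lt hK]
          exact lt_of_le_of_ne (by linarith) hz
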